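/- Conventions. For $k\in\mathbf N$ let $\mathcal G_k$ be the space of marked groups: its points are pairs $(G,S)$ where $G$ is a group and $S=(s_1,\dots,s_k)$ is an ordered generating set of $G$ of cardinality $k$ (a $k$-marking of $G$), up to isomorphisms that match the ordered generating sets. The distance of two points is $e^{-n}$, where $n$ is the largest number such that the $n$-balls around the identity in the two marked Cayley graphs are isomorphic as rooted, directed graphs with edges labelled by the index of the generator (it is $0$ if all balls are isomorphic, and $1$ if not even the $0$-balls are). Let $\mathbf F_2$ be the free group of rank $2$ with its standard marking. Homeomorphisms of $\mathbf R$ act on the right, so that $xy$ means "first $x$, then $y$". Thompson's group $F$ is the group of homeomorphisms of $\mathbf R$ generated by $$f_1(t)=t+1,\qquad f_2(t)=\begin{cases} t & t\le 0,\\ 2t & 0\le t\le 1,\\ t+1 & t\ge 1,\end{cases}$$ $F_{[0,1]}\le F$ is the subgroup of all elements of $F$ that fix every point of $\mathbf R\setminus[0,1]$, and $F_{[0,1]}'$ is its commutator subgroup. For integers $k_1\le k_2$ and $a\in F_{[0,1]}$ let $\mathrm{sp}_{[k_1,k_2]}(a)$ be the homeomorphism that is the identity outside $[k_1,k_2]$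 and acts on each $[k,k+1]\subseteq[k_1,k_2]$, $k\in\mathbf Z$, as the translate $f_1^{-k}af_1^{k}$, that is, $t\mapsto a(t-k)+k$. Theorem (Brin). The free group $\mathbf F_2$ with its standard marking is a limit in $\mathcal G_2$ of $2$-markings of Thompson's group $F$. More explicitly: (i) There are sequences $(a_n)_{n\in\mathbf N}$, $(b_n)_{n\in\mathbf N}$ in $F_{[0,1]}'$ such that, for every $n$, the $n$-ball of the marked Cayley graph of $\langle a_n,b_n\rangle$ with respect to $(a_n,b_n)$ is isomorphic to the $n$-ball of $\mathbf F_2$. (ii) There is an integer $m_0$ such that for every integer $m\ge m_0$ and all sequences $(a_n),(b_n)$ as in (i) the following holds. Put $I_n=[m,m+2n+1]$, $p_n=\mathrm{sp}_{I_n}(a_n)$, $q_n=\mathrm{sp}_{I_n}(b_n)$, $g_n=p_nf_1$ and $h_n=q_nf_2$. Then, for every $n$, $(g_n,h_n)$ is a $2$-marking of $F$ whose $n$-ball is isomorphic to the $n$-ball of $\mathbf F_2$, and $(F,(g_n,h_n))\to\mathbf F_2$ in $\mathcal G_2$ as $n\to\infty$. -/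

import Mathlib

open Filter Topology

/-! ### Marked Cayley graphs and their balls -/

section Balls

variable {k : ℕ} {G H K : Type} [Group G] [Group H] [Group K]

/-- The value in `G` of the word `w` in the letters `S i` (tag `true`) and `(S i)⁻¹`
(tag `false`). -/
def wordEval (S : Fin k → G) (w : List (Fin k × Bool)) : G :=
  (w.map fun x => cond x.2 (S x.1) (S x.1)⁻¹).prod

/-- The vertices of the `n`-ball around `1` in the Cayley graph of `⟨S⟩` with respect to `S`. -/
def cayleyBall (S : Fin k → G) (n : ℕ) : Set G :=
  {g | ∃ w : List (Fin k × Bool), w.length ≤ n ∧ wordEval S w = g}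

theorem wordEval_mem (S : Fin k → G) {n : ℕ} (w : List (Fin k × Bool)) (hw : w.length ≤ n) :
    wordEval S w ∈ cayleyBall S n := ⟨w, hw, rfl⟩

theorem one_mem_cayleyBall (S : Fin k → G) (n : ℕ) : (1 : G) ∈ cayleyBall S n :=
  ⟨[], by simp, by simp [wordEval]⟩

/-- The `n`-balls of the marked Cayley graphs of `(⟨S⟩, S)` and `(⟨T⟩, T)` are isomorphic as
rooted graphs whose edges `x → x * S i` are directed and labelled by `i`. -/
def BallIso (S : Fin k → G) (T : Fin k → H) (n : ℕ) : Prop :=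
  ∃ φ : cayleyBall S n ≃ cayleyBall T n,
    φ ⟨1, one_mem_cayleyBall S n⟩ = ⟨1, one_mem_cayleyBall T n⟩ ∧
    ∀ (i : Fin k) (x y : cayleyBall S n),
      (y : G) = (x : G) * S i ↔ (φ y : H) = (φ x : H) * T i

theorem wordEval_snoc (S : Fin k → G) (w : List (Fin k × Bool)) (x : Fin k × Bool) :
    wordEval S (w ++ [x]) = wordEval S w * cond x.2 (S x.1) (S x.1)⁻¹ := by
  simp [wordEval]

theorem wordEval_eq_lift (S : Fin k → G) (w : List (Fin k × Bool)) :
    wordEval S w = FreeGroup.lift S (FreeGroup.mk w) := by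
  rw [FreeGroup.lift_mk]; rfl

/-- Two marked balls are isomorphic iff the same coincidences hold between short words. -/
theorem ballIso_iff (S : Fin k → G) (T : Fin k → H) (n : ℕ) :
    BallIso S T n ↔ ∀ w v : List (Fin k × Bool), w.length ≤ n → v.length ≤ n →
      (wordEval S w = wordEval S v ↔ wordEval T w = wordEval T v) ∧
      ∀ i, (wordEval S w = wordEval S v * S i ↔ wordEval T w = wordEval T v * T i) := by
  constructor
  · rintro ⟨φ, h1, hφ⟩
    have key : ∀ (w : List (Fin k × Bool)) (hw : w.length ≤ n),
        (φ ⟨wordEval S w, wordEval_mem S w hw⟩ : H) = wordEval T w := by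
      intro w
      induction w using List.reverseRecOn with
      | nil =>
        intro hw
        have : (φ ⟨1, one_mem_cayleyBall S n⟩ : H) = 1 := by rw [h1]
        simpa [wordEval] using this
      | append_singleton w x ih =>
        intro hw
        have hw' : w.length ≤ n := by
          simp only [List.length_append, List.length_singleton] at hw; omega
        obtain ⟨i, b⟩ := x
        cases b with
        | true =>
          have := (hφ i ⟨wordEval S w, wordEval_mem S w hw'⟩
            ⟨wordEval S (w ++ [(i, true)]), wordEval_mem S _ hw⟩).1 (by simp [wordEval_snoc])
          rw [this, ih hw', wordEval_snoc]; rfl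
        | false =>
          have := (hφ i ⟨wordEval S (w ++ [(i, false)]), wordEval_mem S _ hw⟩
            ⟨wordEval S w, wordEval_mem S w hw'⟩).1 (by simp [wordEval_snoc])
          rw [ih hw'] at this
          rw [wordEval_snoc T, this]; simp
    intro w v hw hv
    refine ⟨?_, fun i => ?_⟩
    · rw [← key w hw, ← key v hv]
      constructor
      · intro h; congr 2; exact Subtype.ext h
      · intro h
        exact congrArg Subtype.val (φ.injective (Subtype.ext h))
    · rw [← key w hw, ← key v hv]
      exact hφ i ⟨_, wordEval_mem S v hv⟩ ⟨_, wordEval_mem S w hw⟩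
  · intro h
    choose ws hws hws' using fun x : cayleyBall S n => x.2
    choose wt hwt hwt' using fun x : cayleyBall T n => x.2
    refine ⟨⟨fun x => ⟨_, wordEval_mem T (ws x) (hws x)⟩,
      fun y => ⟨_, wordEval_mem S (wt y) (hwt y)⟩, fun x => ?_, fun y => ?_⟩, ?_, ?_⟩
    · apply Subtype.ext
      change wordEval S _ = _
      rw [← hws' x, (h _ _ (hwt _) (hws x)).1, hwt']
    · apply Subtype.ext
      change wordEval T _ = _
      rw [← hwt' y, ← (h _ _ (hws _) (hwt y)).1, hws']
    · apply Subtype.ext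
      have h2 := (h (ws ⟨1, one_mem_cayleyBall S n⟩) [] (hws _) (by simp)).1.1
        (by rw [hws']; simp [wordEval])
      simpa [wordEval] using h2
    · intro i x y
      change _ ↔ wordEval T (ws y) = wordEval T (ws x) * T i
      rw [← (h _ _ (hws y) (hws x)).2 i, hws', hws']

theorem BallIso.refl (S : Fin k → G) (n : ℕ) : BallIso S S n := by
  rw [ballIso_iff]; simp

theorem BallIso.symm {S : Fin k → G} {T : Fin k → H} {n : ℕ} (h : BallIso S T n) :
    BallIso T S n := by
  rw [ballIso_iff] at h ⊢
  exact fun w v hw hv => ⟨(h w v hw hv).1.symm, fun i => ((h w v hw hv).2 i).symm⟩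

theorem BallIso.trans {S : Fin k → G} {T : Fin k → H} {R : Fin k → K} {n : ℕ}
    (h : BallIso S T n) (h' : BallIso T R n) : BallIso S R n := by
  rw [ballIso_iff] at h h' ⊢
  exact fun w v hw hv => ⟨(h w v hw hv).1.trans (h' w v hw hv).1,
    fun i => ((h w v hw hv).2 i).trans ((h' w v hw hv).2 i)⟩

theorem BallIso.mono {S : Fin k → G} {T : Fin k → H} {n n' : ℕ} (hn : n' ≤ n)
    (h : BallIso S T n) : BallIso S T n' := by
  rw [ballIso_iff] at h ⊢
  exact fun w v hw hv => h w v (hw.trans hn) (hv.trans hn)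

theorem BallIso.of_equiv {S : Fin k → G} {T : Fin k → H} (e : G ≃* H) (he : ∀ i, e (S i) = T i)
    (n : ℕ) : BallIso S T n := by
  have hT : ∀ w, wordEval T w = e (wordEval S w) := by
    intro w
    induction w using List.reverseRecOn with
    | nil => simp [wordEval]
    | append_singleton w x ih =>
      obtain ⟨i, b⟩ := x
      cases b <;> simp [wordEval_snoc, ih, he]
  rw [ballIso_iff]
  intro w v _ _
  refine ⟨by simp [hT], fun i => ?_⟩
  rw [hT, hT, ← he, ← map_mul, e.injective.eq_iff]

end Balls

/-! ### The space of marked groups -/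

/-- `S` is a `k`-marking of `G`: an ordered generating set of cardinality `k`. -/
def IsMarking {k : ℕ} {G : Type} [Group G] (S : Fin k → G) : Prop :=
  Function.Injective S ∧ Subgroup.closure (Set.range S) = ⊤

/-- A group together with a `k`-marking. -/
structure MarkedGroup (k : ℕ) where
  carrier : Type
  [group : Group carrier]
  gens : Fin k → carrier
  isMarking : IsMarking gens

attribute [instance] MarkedGroup.group

/-- Marked groups are equivalent if some isomorphism matches the ordered generating sets. -/
instance MarkedGroup.setoid (k : ℕ) : Setoid (MarkedGroup k) where
  r A B := ∃ e : A.carrier ≃* B.carrier, ∀ i, e (A.gens i) = B.gens i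
  iseqv :=
    { refl := fun A => ⟨MulEquiv.refl _, fun _ => rfl⟩
      symm := fun ⟨e, he⟩ => ⟨e.symm, fun i => by rw [← he i, e.symm_apply_apply]⟩
      trans := fun ⟨e, he⟩ ⟨e', he'⟩ => ⟨e.trans e', fun i => by
        rw [MulEquiv.trans_apply, he, he']⟩ }

/-- The set of marked groups on `k` generators, up to equivalence. -/
def MarkedGroupSpace (k : ℕ) : Type 1 := Quotient (MarkedGroup.setoid k)

namespace MarkedGroup

variable {k : ℕ}

/-- The numbers `e⁻ⁿ` such that the `n`-balls of `A` and `B` are isomorphic, together with `1`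
(which only matters if not even the `0`-balls are isomorphic because of loops). -/
def distSet (A B : MarkedGroup k) : Set ℝ :=
  insert 1 ((fun n : ℕ => Real.exp (-(n : ℝ))) '' {n | BallIso A.gens B.gens n})

/-- The distance `e⁻ⁿ`, with `n` the largest number such that the `n`-balls of `A` and `B` are
isomorphic (and `0` if all balls are). -/
noncomputable def distance (A B : MarkedGroup k) : ℝ := sInf (distSet A B)

theorem distSet_nonneg {A B : MarkedGroup k} : ∀ u ∈ distSet A B, 0 ≤ u := by
  rintro u (rfl | ⟨n, -, rfl⟩)
  · exact zero_le_one
  · exact (Real.exp_pos _).le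

theorem distSet_bddBelow (A B : MarkedGroup k) : BddBelow (distSet A B) :=
  ⟨0, fun _ h => distSet_nonneg _ h⟩

theorem distSet_nonempty (A B : MarkedGroup k) : (distSet A B).Nonempty :=
  ⟨1, Set.mem_insert _ _⟩

theorem distance_le {A B : MarkedGroup k} {n : ℕ} (h : BallIso A.gens B.gens n) :
    distance A B ≤ Real.exp (-(n : ℝ)) :=
  csInf_le (distSet_bddBelow A B) (Or.inr ⟨n, h, rfl⟩)

theorem ballIso_of_distance_lt {A B : MarkedGroup k} {n : ℕ}
    (h : distance A B < Real.exp (-(n : ℝ))) : BallIso A.gens B.gens n := by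
  obtain ⟨u, hu, hlt⟩ := exists_lt_of_csInf_lt (distSet_nonempty A B) h
  rcases hu with rfl | ⟨j, hj, rfl⟩
  · exact absurd hlt (not_lt.2 (Real.exp_le_one_iff.2 (by simp)))
  · refine BallIso.mono ?_ hj
    have h' := Real.exp_lt_exp.1 hlt
    have : (n : ℝ) < j := by linarith
    exact_mod_cast this.le

theorem distance_symm (A B : MarkedGroup k) : distance A B = distance B A := by
  have : distSet A B = distSet B A := by
    unfold distSet
    congr 2
    ext n
    exact ⟨BallIso.symm, BallIso.symm⟩
  rw [distance, distance, this]

theorem distance_triangle (A B C : MarkedGroup k) :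
    distance A C ≤ distance A B + distance B C := by
  have key : ∀ u ∈ distSet A B, ∀ v ∈ distSet B C, distance A C ≤ u + v := by
    intro u hu v hv
    have h1 : distance A C ≤ 1 := csInf_le (distSet_bddBelow A C) (Set.mem_insert _ _)
    have hu0 := distSet_nonneg u hu
    have hv0 := distSet_nonneg v hv
    rcases hu with rfl | ⟨n, hn, rfl⟩
    · linarith
    rcases hv with rfl | ⟨j, hj, rfl⟩
    · linarith
    rcases le_total n j with h | h
    · have := distance_le (BallIso.trans hn (BallIso.mono h hj))
      linarith
    · have := distance_le (BallIso.trans (BallIso.mono h hn) hj)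
      linarith
  have h2 : ∀ u ∈ distSet A B, distance A C - u ≤ distance B C := fun u hu =>
    le_csInf (distSet_nonempty B C) fun v hv => by linarith [key u hu v hv]
  have h3 : distance A C - distance B C ≤ distance A B :=
    le_csInf (distSet_nonempty A B) fun u hu => by linarith [h2 u hu]
  linarith

theorem distance_eq_zero_of_equiv {A B : MarkedGroup k} (h : A ≈ B) : distance A B = 0 := by
  obtain ⟨e, he⟩ := h
  refine le_antisymm ?_ (le_csInf (distSet_nonempty A B) distSet_nonneg)
  have ht : Tendsto (fun n : ℕ => Real.exp (-(n : ℝ))) atTop (𝓝 0) :=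
    Real.tendsto_exp_neg_atTop_nhds_zero.comp tendsto_natCast_atTop_atTop
  exact ge_of_tendsto' ht fun n => distance_le (BallIso.of_equiv e he n)

theorem lift_surjective (A : MarkedGroup k) : Function.Surjective (FreeGroup.lift A.gens) := by
  rw [← MonoidHom.range_eq_top, FreeGroup.range_lift_eq_closure]
  exact A.isMarking.2

theorem equiv_of_distance_eq_zero {A B : MarkedGroup k} (h : distance A B = 0) : A ≈ B := by
  have hb : ∀ n, BallIso A.gens B.gens n := fun n =>
    ballIso_of_distance_lt (by rw [h]; exact Real.exp_pos _)
  have hker : (FreeGroup.lift A.gens).ker = (FreeGroup.lift B.gens).ker := by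
    ext x
    have h1 := ((ballIso_iff _ _ x.toWord.length).1 (hb _) x.toWord [] le_rfl (by simp)).1
    simpa only [wordEval_eq_lift, FreeGroup.mk_toWord, ← FreeGroup.one_eq_mk, map_one,
      ← MonoidHom.mem_ker] using h1
  refine ⟨((QuotientGroup.quotientKerEquivOfSurjective _ A.lift_surjective).symm.trans
    (QuotientGroup.quotientMulEquivOfEq hker)).trans
    (QuotientGroup.quotientKerEquivOfSurjective _ B.lift_surjective), fun i => ?_⟩
  have h1 : (QuotientGroup.quotientKerEquivOfSurjective _ A.lift_surjective).symm (A.gens i)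
      = ((FreeGroup.of i : FreeGroup (Fin k)) : FreeGroup (Fin k) ⧸ (FreeGroup.lift A.gens).ker) := by
    rw [MulEquiv.symm_apply_eq]
    exact (FreeGroup.lift_apply_of (f := A.gens) (x := i)).symm
  rw [MulEquiv.trans_apply, MulEquiv.trans_apply, h1, QuotientGroup.quotientMulEquivOfEq_mk]
  exact FreeGroup.lift_apply_of

theorem distance_congr (A B A' B' : MarkedGroup k) (hA : A ≈ A') (hB : B ≈ B') :
    distance A B = distance A' B' := by
  have h1 := distance_eq_zero_of_equiv hA
  have h2 := distance_eq_zero_of_equiv hB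
  have h1' := (distance_symm A' A).trans h1
  have h2' := (distance_symm B' B).trans h2
  apply le_antisymm
  · linarith [distance_triangle A A' B, distance_triangle A' B' B]
  · linarith [distance_triangle A' A B', distance_triangle A B B']

end MarkedGroup

/-- The metric of the space of marked groups. -/
noncomputable instance MarkedGroupSpace.metricSpace (k : ℕ) : MetricSpace (MarkedGroupSpace k) where
  dist := Quotient.lift₂ MarkedGroup.distance MarkedGroup.distance_congr
  dist_self := by rintro ⟨A⟩; exact MarkedGroup.distance_eq_zero_of_equiv (Setoid.refl A)
  dist_comm := by rintro ⟨A⟩ ⟨B⟩; exact MarkedGroup.distance_symm A B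
  dist_triangle := by rintro ⟨A⟩ ⟨B⟩ ⟨C⟩; exact MarkedGroup.distance_triangle A B C
  eq_of_dist_eq_zero := by
    rintro ⟨A⟩ ⟨B⟩ h
    exact Quotient.sound (MarkedGroup.equiv_of_distance_eq_zero h)

/-- The point `(G, S)` of the space of marked groups. -/
def MarkedGroupSpace.mk {k : ℕ} {G : Type} [Group G] (S : Fin k → G) (hS : IsMarking S) :
    MarkedGroupSpace k :=
  Quotient.mk _ ⟨G, S, hS⟩

/-- The standard marking of the free group of rank `k`. -/
theorem isMarking_freeGroup_of (k : ℕ) :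
    IsMarking (FreeGroup.of : Fin k → FreeGroup (Fin k)) :=
  ⟨FreeGroup.of_injective, FreeGroup.closure_range_of _⟩

/-! ### Thompson's group

Orientation preserving homeomorphisms of the line are the order automorphisms `ℝ ≃o ℝ`, which
Mathlib multiplies by `(x * y) t = x (y t)`. The product `x y` of right actions (first `x`, then
`y`) is therefore written `y * x`. -/

namespace Thompson

/-- The translation `t ↦ t + 1`. -/
noncomputable def f₁ : ℝ ≃o ℝ := OrderIso.addRight 1

/-- The map `t ↦ t` for `t ≤ 0`, `2 t` for `0 ≤ t ≤ 1` and `t + 1` for `1 ≤ t`. -/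
noncomputable def f₂ : ℝ ≃o ℝ :=
  StrictMono.orderIsoOfRightInverse
    (fun t : ℝ => if t ≤ 0 then t else if t ≤ 1 then 2 * t else t + 1)
    (by
      intro s t hst
      dsimp only
      split_ifs <;> linarith)
    (fun t : ℝ => if t ≤ 0 then t else if t ≤ 2 then t / 2 else t - 1)
    (by
      intro t
      dsimp only
      split_ifs <;> linarith)

/-- Thompson's group `F`, as the group of homeomorphisms of the line generated by `f₁, f₂`. -/
def F : Subgroup (ℝ ≃o ℝ) := Subgroup.closure {f₁, f₂}

/-- The subgroup of all elements of `F` that fix every point outside `[0, 1]`. -/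
def F₂ : Subgroup (ℝ ≃o ℝ) where
  carrier := {g | g ∈ F ∧ ∀ t : ℝ, t ∉ Set.Icc (0 : ℝ) 1 → g t = t}
  one_mem' := ⟨F.one_mem, fun _ _ => rfl⟩
  mul_mem' := fun {x y} hx hy => ⟨F.mul_mem hx.1 hy.1, fun t ht => by
    rw [RelIso.mul_apply, hy.2 t ht, hx.2 t ht]⟩
  inv_mem' := fun {x} hx => ⟨F.inv_mem hx.1, fun t ht => by
    have h := hx.2 t ht
    calc x⁻¹ t = x⁻¹ (x t) := by rw [h]
      _ = t := RelIso.inv_apply_self x t⟩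

theorem F₂_zero (a : F₂) : (a : ℝ ≃o ℝ) 0 = 0 := by
  obtain ⟨a, -, ha⟩ := a
  change a 0 = 0
  rcases lt_trichotomy (a 0) 0 with h | h | h
  · have h1 := ha (a 0) (fun h' => absurd h'.1 (not_le.2 h))
    have := a.injective h1
    linarith
  · exact h
  · have h1 : a.symm (a 0 / 2) < 0 := by
      rw [OrderIso.symm_apply_lt]; linarith
    have h2 := ha _ (fun h' => absurd h'.1 (not_le.2 h1))
    rw [OrderIso.apply_symm_apply] at h2
    linarith

theorem F₂_one (a : F₂) : (a : ℝ ≃o ℝ) 1 = 1 := by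
  obtain ⟨a, -, ha⟩ := a
  change a 1 = 1
  rcases lt_trichotomy (a 1) 1 with h | h | h
  · have h1 : 1 < a.symm ((a 1 + 1) / 2) := by
      rw [OrderIso.lt_symm_apply]; linarith
    have h2 := ha _ (fun h' => absurd h'.2 (not_le.2 h1))
    rw [OrderIso.apply_symm_apply] at h2
    linarith
  · exact h
  · have h1 := ha (a 1) (fun h' => absurd h'.2 (not_le.2 h))
    have := a.injective h1
    linarith

/-- The map that is the identity outside `[k₁, k₂]` and acts on each `[k, k + 1] ⊆ [k₁, k₂]`,
`k` an integer, as the conjugate `t ↦ a (t - k) + k`. (At the integers both formulas give the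
identity, as `a` fixes `0` and `1`.) -/
noncomputable def spreadFun (k₁ k₂ : ℤ) (a : ℝ → ℝ) (t : ℝ) : ℝ :=
  if k₁ ≤ ⌊t⌋ ∧ ⌊t⌋ < k₂ then a (t - ⌊t⌋) + ⌊t⌋ else t

theorem floor_spreadFun (k₁ k₂ : ℤ) (a : F₂) (t : ℝ) :
    ⌊spreadFun k₁ k₂ (a : ℝ ≃o ℝ) t⌋ = ⌊t⌋ := by
  unfold spreadFun
  split_ifs
  · rw [Int.floor_eq_iff]
    have h0 : (0 : ℝ) ≤ (a : ℝ ≃o ℝ) (t - ⌊t⌋) := by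
      rw [← F₂_zero a, OrderIso.le_iff_le]; linarith [Int.floor_le t]
    have h1 : (a : ℝ ≃o ℝ) (t - ⌊t⌋) < 1 := by
      rw [← F₂_one a, OrderIso.lt_iff_lt]; linarith [Int.lt_floor_add_one t]
    constructor <;> linarith
  · rfl

/-- `spreadFun k₁ k₂ a` as a homeomorphism. -/
noncomputable def spread (k₁ k₂ : ℤ) (a : F₂) : ℝ ≃o ℝ :=
  StrictMono.orderIsoOfRightInverse (spreadFun k₁ k₂ (a : ℝ ≃o ℝ))
    (by
      intro s t hst
      rcases (Int.floor_mono hst.le).lt_or_eq with h | h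
      · refine lt_of_not_ge fun h' => absurd (Int.floor_mono h') (not_le.2 ?_)
        rwa [floor_spreadFun, floor_spreadFun]
      · unfold spreadFun
        rw [h]
        split_ifs
        · have : (a : ℝ ≃o ℝ) (s - ⌊t⌋) < (a : ℝ ≃o ℝ) (t - ⌊t⌋) := by
            rw [OrderIso.lt_iff_lt]; linarith
          linarith
        · exact hst)
    (spreadFun k₁ k₂ ((a⁻¹ : F₂) : ℝ ≃o ℝ))
    (by
      intro t
      have h := floor_spreadFun k₁ k₂ a⁻¹ t
      conv_lhs => unfold spreadFun
      change (if k₁ ≤ ⌊spreadFun k₁ k₂ ((a⁻¹ : F₂) : ℝ ≃o ℝ) t⌋ ∧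
        ⌊spreadFun k₁ k₂ ((a⁻¹ : F₂) : ℝ ≃o ℝ) t⌋ < k₂ then
        (a : ℝ ≃o ℝ) (spreadFun k₁ k₂ ((a⁻¹ : F₂) : ℝ ≃o ℝ) t -
          ⌊spreadFun k₁ k₂ ((a⁻¹ : F₂) : ℝ ≃o ℝ) t⌋) +
          ⌊spreadFun k₁ k₂ ((a⁻¹ : F₂) : ℝ ≃o ℝ) t⌋ else
          spreadFun k₁ k₂ ((a⁻¹ : F₂) : ℝ ≃o ℝ) t) = t
      rw [h]
      unfold spreadFun
      split_ifs
      · rw [add_sub_cancel_right, InvMemClass.coe_inv, RelIso.apply_inv_self]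
        ring
      · rfl)

/-- `(a n, b n)` are pairs of elements of the commutator subgroup of `F₂` such that the `n`-ball
of the Cayley graph of `⟨a n, b n⟩` is isomorphic to that of the free group of rank two. -/
def LooksFree (a b : ℕ → F₂) : Prop :=
  ∀ n, a n ∈ commutator F₂ ∧ b n ∈ commutator F₂ ∧
    BallIso ![a n, b n] (FreeGroup.of : Fin 2 → FreeGroup (Fin 2)) n

end Thompson

namespace Thompson

/-! ### Elements of `F` and their supports -/

/-! Write `P`, `Q` for the spreads of `a`, `b`, and `g = f₁ * P`, `h = f₂ * Q`.

Short relations. Inside the window of the spreads, `g` and `h` carry each unit interval to the next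
one, acting as `a` or `b` followed by a unit translation. A word of length at most `2 n + 1` drifts
over at most `2 n + 1` unit steps, so some starting interval never leaves the window. If the word is
a relation, its net translation is zero and the same word in `a`, `b` is trivial on `[0, 1]`, hence
trivial (`mk_eq_one_of_wordEval_spread`). Isomorphism of `n`-balls with the free group means exactly
that there are no nontrivial relations of length at most `2 n + 1` (`BallIso.mk_eq_one`,
`ballIso_of_mk_eq_one`).

Generation. Left of the window `P` and `Q` are invisible, so `h⁻¹ * g` is `f₂⁻¹ * f₁ = leftGen 1` up
to an error supported far to the right. With a conjugate by `g` it yields, up to such errors, every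
element of `F` supported on `(-∞, 1]` (`mem_closure_of_mem_F`). Pushing one error off the other
makes errors vanish in commutators, so the commutator subgroup of `F₂` is generated exactly
(`commutator_F₂_le`). It contains `a` and `b`; their conjugates rebuild `P` and `Q`, and dividing
these out leaves `f₁` and `f₂` (`F_le_of_mem`).

Existence of `a`, `b`. For one reduced word, a chain of overlapping bumps moves a point steadily to
the right (`exists_runs`, `exists_follows`). Finitely many words are handled by disjoint supports,
and a commutator with a displacing element, followed by a conjugation, puts the pair into the
commutator subgroup of `F₂` (`exists_ballIso`). -/

theorem f₁_apply (t : ℝ) : f₁ t = t + 1 := rfl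

theorem f₁_zpow_apply (k : ℤ) (t : ℝ) : (f₁ ^ k) t = t + k := by
  induction k generalizing t with
  | zero => simp
  | succ k ih => rw [zpow_add_one, RelIso.mul_apply, ih, f₁_apply]; push_cast; ring
  | pred k ih =>
    have h : f₁⁻¹ t = t - 1 := by
      rw [← f₁.injective.eq_iff, RelIso.apply_inv_self, f₁_apply]; ring
    rw [zpow_sub_one, RelIso.mul_apply, ih, h]; push_cast; ring

theorem f₂_apply (t : ℝ) :
    f₂ t = if t ≤ 0 then t else if t ≤ 1 then 2 * t else t + 1 := rfl

theorem f₂_apply_of_one_le {t : ℝ} (ht : 1 ≤ t) : f₂ t = t + 1 := by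
  rw [f₂_apply]; split_ifs <;> linarith

theorem f₂_inv_apply (t : ℝ) :
    f₂⁻¹ t = if t ≤ 0 then t else if t ≤ 2 then t / 2 else t - 1 := rfl

theorem f₁_mem : f₁ ∈ F := Subgroup.subset_closure (by simp)

theorem f₂_mem : f₂ ∈ F := Subgroup.subset_closure (by simp)

/-- The homeomorphisms that fix every point outside `A`. -/
def supportedIn (A : Set ℝ) : Subgroup (ℝ ≃o ℝ) where
  carrier := {x | ∀ t ∉ A, x t = t}
  one_mem' := fun _ _ => rfl
  mul_mem' := fun {x y} hx hy t ht => by rw [RelIso.mul_apply, hy t ht, hx t ht]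
  inv_mem' := fun {x} hx t ht => by
    calc x⁻¹ t = x⁻¹ (x t) := by rw [hx t ht]
      _ = t := RelIso.inv_apply_self x t

theorem supportedIn_mono {A B : Set ℝ} (h : A ⊆ B) : supportedIn A ≤ supportedIn B :=
  fun _ hx t ht => hx t fun h' => ht (h h')

theorem apply_mem_of_supportedIn {A : Set ℝ} {x : ℝ ≃o ℝ} (hx : x ∈ supportedIn A) {t : ℝ}
    (ht : t ∈ A) : x t ∈ A := by
  by_contra h
  exact h (by rwa [x.injective (hx _ h)])

theorem conj_mem_supportedIn {A B : Set ℝ} {x y : ℝ ≃o ℝ} (hx : x ∈ supportedIn A)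
    (hy : ∀ t ∈ A, y t ∈ B) : y * x * y⁻¹ ∈ supportedIn B := by
  intro t ht
  have : y⁻¹ t ∉ A := fun h => ht (by simpa using hy _ h)
  rw [RelIso.mul_apply, RelIso.mul_apply, hx _ this, RelIso.apply_inv_self]

theorem commute_of_disjoint {A B : Set ℝ} (hAB : Disjoint A B) {x y : ℝ ≃o ℝ}
    (hx : x ∈ supportedIn A) (hy : y ∈ supportedIn B) : Commute x y := by
  ext t
  rw [RelIso.mul_apply, RelIso.mul_apply]
  by_cases hA : t ∈ A
  · rw [hy t (Set.disjoint_left.1 hAB hA),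
      hy _ (Set.disjoint_left.1 hAB (apply_mem_of_supportedIn hx hA))]
  · by_cases hB : t ∈ B
    · rw [hx t hA, hx _ (Set.disjoint_right.1 hAB (apply_mem_of_supportedIn hy hB))]
    · rw [hx t hA, hy t hB, hx t hA]

/-! ### The elements supported on a left half line -/

/-- The element of `F` supported on `(-∞, i]` that contracts `[i - 2, i]` to `[i - 1, i]` and is
`t ↦ t + 1` on `(-∞, i - 2]`. -/
noncomputable def leftGen (i : ℤ) : ℝ ≃o ℝ := f₁ ^ (i - 1) * (f₂⁻¹ * f₁) * f₁ ^ (1 - i)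

theorem leftGen_mem (i : ℤ) : leftGen i ∈ F :=
  F.mul_mem (F.mul_mem (F.zpow_mem f₁_mem _) (F.mul_mem (F.inv_mem f₂_mem) f₁_mem))
    (F.zpow_mem f₁_mem _)

theorem leftGen_apply (i : ℤ) (t : ℝ) :
    leftGen i t = if t ≤ i - 2 then t + 1 else if t ≤ i then (t + i) / 2 else t := by
  simp only [leftGen, RelIso.mul_apply, f₁_zpow_apply, f₁_apply, f₂_inv_apply]
  push_cast
  split_ifs <;> linarith

theorem f₂_inv_mul_f₁ : f₂⁻¹ * f₁ = leftGen 1 := by simp [leftGen]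

theorem leftGen_mem_supportedIn (i : ℤ) : leftGen i ∈ supportedIn (Set.Iic (i : ℝ)) := by
  intro t ht
  rw [Set.mem_Iic, not_le] at ht
  rw [leftGen_apply]; split_ifs <;> linarith

theorem le_leftGen (i : ℤ) (t : ℝ) : t ≤ leftGen i t := by
  rw [leftGen_apply]; split_ifs <;> linarith

theorem lt_leftGen {i : ℤ} {t : ℝ} (ht : t < i) : t < leftGen i t := by
  rw [leftGen_apply]; split_ifs <;> linarith

theorem leftGen_apply_self (i : ℤ) : leftGen i i = i := by
  rw [leftGen_apply]; split_ifs <;> linarith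

theorem f₁_conj_leftGen (i k : ℤ) : f₁ ^ k * leftGen i * (f₁ ^ k)⁻¹ = leftGen (i + k) := by
  have h : (1 : ℤ) - (i + k) = 1 - i + -k := by ring
  have h' : i + k - 1 = k + (i - 1) := by ring
  simp only [leftGen]
  rw [h, h', zpow_add, zpow_add, zpow_neg]
  group

/-- The support `(-∞, j - 1]` of `leftGen (j - 1)` lies where `leftGen i` is the unit translation,
so conjugation by `leftGen i` just shifts the index. These are the relations of the infinite
presentation of `F`. -/
theorem leftGen_mul {i j : ℤ} (h : j < i) :
    leftGen j * leftGen i = leftGen i * leftGen (j - 1) := by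
  ext t
  have : (j : ℝ) ≤ i - 1 := by exact_mod_cast Int.le_sub_one_of_lt h
  simp only [RelIso.mul_apply, leftGen_apply]
  push_cast
  split_ifs <;> linarith

/-- The product of the `leftGen i` over a list of indices. -/
noncomputable def leftWord (l : List ℤ) : ℝ ≃o ℝ := (l.map leftGen).prod

theorem leftWord_cons (i : ℤ) (l : List ℤ) : leftWord (i :: l) = leftGen i * leftWord l := by
  simp [leftWord]

theorem leftWord_append (l l' : List ℤ) : leftWord (l ++ l') = leftWord l * leftWord l' := by
  simp [leftWord]

theorem leftWord_mem_supportedIn {l : List ℤ} {i : ℤ} (h : ∀ k ∈ l, k ≤ i) :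
    leftWord l ∈ supportedIn (Set.Iic (i : ℝ)) := by
  refine Subgroup.list_prod_mem _ fun x hx => ?_
  obtain ⟨k, hk, rfl⟩ := List.mem_map.1 hx
  exact supportedIn_mono (Set.Iic_subset_Iic.2 (by exact_mod_cast h k hk))
    (leftGen_mem_supportedIn k)

theorem le_leftWord (l : List ℤ) (t : ℝ) : t ≤ leftWord l t := by
  induction l with
  | nil => exact le_rfl
  | cons i l ih => rw [leftWord_cons, RelIso.mul_apply]; exact ih.trans (le_leftGen _ _)

theorem inv_leftWord_mul_leftGen (v : List ℤ) (j : ℤ) :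
    ∃ u' v' : List ℤ, (leftWord v)⁻¹ * leftGen j = leftWord u' * (leftWord v')⁻¹ := by
  induction v generalizing j with
  | nil => exact ⟨[j], [], by simp [leftWord]⟩
  | cons i v ih =>
    rcases lt_trichotomy j i with h | rfl | h
    · obtain ⟨u', v', h'⟩ := ih (j - 1)
      refine ⟨u', i :: v', ?_⟩
      have : (leftGen i)⁻¹ * leftGen j = leftGen (j - 1) * (leftGen i)⁻¹ := by
        rw [inv_mul_eq_iff_eq_mul, ← mul_assoc, eq_mul_inv_iff_mul_eq, leftGen_mul h]
      rw [leftWord_cons, leftWord_cons, mul_inv_rev, mul_inv_rev, mul_assoc, this, ← mul_assoc, h',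
        mul_assoc]
    · exact ⟨[], v, by simp [leftWord]⟩
    · obtain ⟨u', v', h'⟩ := ih j
      refine ⟨u', (i - 1) :: v', ?_⟩
      have : (leftGen i)⁻¹ * leftGen j = leftGen j * (leftGen (i - 1))⁻¹ := by
        rw [inv_mul_eq_iff_eq_mul, ← mul_assoc, eq_mul_inv_iff_mul_eq, leftGen_mul h]
      rw [leftWord_cons, leftWord_cons, mul_inv_rev, mul_inv_rev, mul_assoc, this, ← mul_assoc, h',
        mul_assoc]

theorem exists_leftWord_of_mem_closure {x : ℝ ≃o ℝ}
    (hx : x ∈ Subgroup.closure (Set.range leftGen)) :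
    ∃ u v : List ℤ, x = leftWord u * (leftWord v)⁻¹ := by
  induction hx using Subgroup.closure_induction_right with
  | one => exact ⟨[], [], by simp [leftWord]⟩
  | mul_right x _ y hy ih =>
    obtain ⟨j, rfl⟩ := hy
    obtain ⟨u, v, rfl⟩ := ih
    obtain ⟨u', v', h⟩ := inv_leftWord_mul_leftGen v j
    exact ⟨u ++ u', v', by rw [leftWord_append, mul_assoc, h, mul_assoc]⟩
  | mul_inv_cancel x _ y hy ih =>
    obtain ⟨j, rfl⟩ := hy
    obtain ⟨u, v, rfl⟩ := ih
    exact ⟨u, j :: v, by rw [leftWord_cons, mul_inv_rev, mul_assoc]⟩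

/-- Conjugation by `f₁` permutes the `leftGen i`, and `f₂` is `f₁ * (leftGen 1)⁻¹`, so powers of
`f₁` can be collected on the left. -/
theorem exists_zpow_mul_of_mem_F {x : ℝ ≃o ℝ} (hx : x ∈ F) :
    ∃ k : ℤ, ∃ y ∈ Subgroup.closure (Set.range leftGen), x = f₁ ^ k * y := by
  have hconj : ∀ (k : ℤ), ∀ y ∈ Subgroup.closure (Set.range leftGen),
      f₁ ^ k * y * (f₁ ^ k)⁻¹ ∈ Subgroup.closure (Set.range leftGen) := by
    intro k y hy
    induction hy using Subgroup.closure_induction with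
    | mem y hy =>
      obtain ⟨i, rfl⟩ := hy
      rw [f₁_conj_leftGen]
      exact Subgroup.subset_closure ⟨_, rfl⟩
    | one => simp
    | mul y z _ _ hy hz => rw [← conj_mul]; exact mul_mem hy hz
    | inv y _ hy => rw [← conj_inv]; exact inv_mem hy
  have hf₂ : f₂ = f₁ ^ (1 : ℤ) * (leftGen 1)⁻¹ := by simp [← f₂_inv_mul_f₁]
  have hd : leftGen 1 ∈ Subgroup.closure (Set.range leftGen) := Subgroup.subset_closure ⟨1, rfl⟩
  have key : ∀ (k l : ℤ) (y z : ℝ ≃o ℝ), f₁ ^ k * y * (f₁ ^ l * z) =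
      f₁ ^ (k + l) * ((f₁ ^ (-l) * y * (f₁ ^ (-l))⁻¹) * z) := by
    intro k l y z; rw [zpow_add]; group
  have key_inv : ∀ (k : ℤ) (y : ℝ ≃o ℝ), (f₁ ^ k * y)⁻¹ =
      f₁ ^ (-k) * (f₁ ^ k * y⁻¹ * (f₁ ^ k)⁻¹) := by
    intro k y; group
  induction hx using Subgroup.closure_induction with
  | mem x hx =>
    rcases hx with rfl | rfl
    · exact ⟨1, 1, one_mem _, by simp⟩
    · exact ⟨1, _, inv_mem hd, hf₂⟩
  | one => exact ⟨0, 1, one_mem _, by simp⟩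
  | mul x x' _ _ hx hx' =>
    obtain ⟨k, y, hy, rfl⟩ := hx
    obtain ⟨l, z, hz, rfl⟩ := hx'
    exact ⟨k + l, _, mul_mem (hconj _ _ hy) hz, key k l y z⟩
  | inv x _ hx =>
    obtain ⟨k, y, hy, rfl⟩ := hx
    exact ⟨-k, _, hconj _ _ (inv_mem hy), key_inv k y⟩

/-- Powers of the largest generator can be collected on the left. -/
theorem leftWord_split {i : ℤ} (l : List ℤ) (h : ∀ k ∈ l, k ≤ i) :
    (∃ l' : List ℤ, (∀ k ∈ l', k ≤ i - 1) ∧ l'.length = l.length ∧ leftWord l = leftWord l') ∨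
    ∃ l' : List ℤ, (∀ k ∈ l', k ≤ i) ∧ l'.length + 1 = l.length ∧
      leftWord l = leftGen i * leftWord l' := by
  induction l with
  | nil => exact Or.inl ⟨[], by simp, rfl, rfl⟩
  | cons j l ih =>
    rw [List.forall_mem_cons] at h
    rcases h.1.lt_or_eq with hj | rfl
    · rcases ih h.2 with ⟨l', h1, h2, h3⟩ | ⟨l', h1, h2, h3⟩
      · refine Or.inl ⟨j :: l', ?_, by simp [h2], by rw [leftWord_cons, leftWord_cons, h3]⟩
        exact List.forall_mem_cons.2 ⟨by omega, h1⟩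
      · refine Or.inr ⟨(j - 1) :: l', ?_, by simp [← h2], ?_⟩
        · exact List.forall_mem_cons.2 ⟨by omega, h1⟩
        · rw [leftWord_cons, leftWord_cons, h3, ← mul_assoc, leftGen_mul hj, mul_assoc]
    · exact Or.inr ⟨l, h.2, rfl, leftWord_cons _ _⟩

/-! ### Generators for the elements fixing a right half line -/

theorem leftGen_mem_closure_Iic {i j : ℤ} (h : i ≤ j) :
    leftGen i ∈ Subgroup.closure (Set.image leftGen (Set.Iic j)) :=
  Subgroup.subset_closure ⟨i, h, rfl⟩

theorem leftGen_conj_mem {i j : ℤ} (hj : j < i) {x : ℝ ≃o ℝ}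
    (hx : x ∈ Subgroup.closure (Set.image leftGen (Set.Iic (j - 1)))) :
    leftGen i * x * (leftGen i)⁻¹ ∈ Subgroup.closure (Set.image leftGen (Set.Iic j)) := by
  induction hx using Subgroup.closure_induction with
  | mem y hy =>
    obtain ⟨k, hk, rfl⟩ := hy
    rw [Set.mem_Iic] at hk
    have := leftGen_mul (i := i) (j := k + 1) (by omega)
    rw [add_sub_cancel_right] at this
    rw [← this, mul_inv_cancel_right]
    exact leftGen_mem_closure_Iic (by omega)
  | one => simp
  | mul y z _ _ hy hz => rw [← conj_mul]; exact mul_mem hy hz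
  | inv y _ hy => rw [← conj_inv]; exact inv_mem hy

/-- If `u` begins with the generator supported up to `i` and `v` does not involve it, then
`leftWord u * (leftWord v)⁻¹` moves points immediately to the left of `i`. -/
theorem leftWord_ne {i : ℤ} {x : ℝ ≃o ℝ} {u v : List ℤ}
    (hu : ∀ k ∈ u, k ≤ i) (hv : ∀ k ∈ v, k ≤ i - 1) (hx : ∀ t : ℝ, (i : ℝ) - 1 ≤ t → x t = t)
    (h : x * leftWord v = leftGen i * leftWord u) : False := by
  have h1 := congrArg (fun y : ℝ ≃o ℝ => y ((i : ℝ) - 1 / 2)) h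
  simp only [RelIso.mul_apply] at h1
  rw [leftWord_mem_supportedIn hv _ (by rw [Set.mem_Iic, not_le]; push_cast; linarith),
    hx _ (by linarith)] at h1
  have h2 := le_leftWord u ((i : ℝ) - 1 / 2)
  have h3 : leftWord u ((i : ℝ) - 1 / 2) < i := by
    rw [← not_le]
    intro h4
    rcases h4.lt_or_eq with h5 | h5
    · have := leftWord_mem_supportedIn hu (leftWord u ((i : ℝ) - 1 / 2)) (by simpa using h5)
      have := (leftWord u).injective this
      linarith
    · rw [← h5, leftGen_apply_self] at h1
      linarith
  linarith [lt_leftGen h3]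

/-- Compare the occurrences of the largest index `i > j` in numerator and denominator. On neither
side: lower `i`. On one side only: the element moves points close to `i`, which is excluded. On both
sides: conjugate it away. The outer induction is on total length, the inner one on the gap between
`i` and `j`. -/
theorem mem_closure_of_leftWord (n : ℕ) : ∀ (e : ℕ) (i j : ℤ) (u v : List ℤ),
    u.length + v.length ≤ n → i ≤ j + e → (∀ k ∈ u, k ≤ i) → (∀ k ∈ v, k ≤ i) →
    (∀ t : ℝ, (j : ℝ) ≤ t → (leftWord u * (leftWord v)⁻¹) t = t) →
    leftWord u * (leftWord v)⁻¹ ∈ Subgroup.closure (Set.image leftGen (Set.Iic j)) := by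
  induction n with
  | zero =>
    intro e i j u v hn _ _ _ _
    have hu : u = [] := List.length_eq_zero_iff.1 (by omega)
    have hv : v = [] := List.length_eq_zero_iff.1 (by omega)
    simp [hu, hv, leftWord]
  | succ n ihn =>
    intro e
    induction e with
    | zero =>
      intro i j u v _ hij hu hv _
      refine mul_mem ?_ (inv_mem ?_) <;>
      · refine Subgroup.list_prod_mem _ fun x hx => ?_
        obtain ⟨k, hk, rfl⟩ := List.mem_map.1 hx
        refine leftGen_mem_closure_Iic ?_
        first
          | have := hu k hk; push_cast at hij; omega
          | have := hv k hk; push_cast at hij; omega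
    | succ e ihe =>
      intro i j u v hn hij hu hv hx
      rcases lt_or_ge j i with hji | hji
      swap
      · exact ihe i j u v hn (by omega) hu hv hx
      have hji' : (j : ℝ) ≤ i - 1 := by exact_mod_cast Int.le_sub_one_of_lt hji
      rcases leftWord_split u hu with ⟨u', hu1, hu2, hu3⟩ | ⟨u', hu1, hu2, hu3⟩ <;>
      rcases leftWord_split v hv with ⟨v', hv1, hv2, hv3⟩ | ⟨v', hv1, hv2, hv3⟩
      · rw [hu3, hv3] at hx ⊢
        exact ihe (i - 1) j u' v' (by omega) (by push_cast at hij; omega) hu1 hv1 hx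
      · exfalso
        refine leftWord_ne (x := (leftWord u * (leftWord v)⁻¹)⁻¹) hv1 hu1 (fun t ht => ?_)
          (by rw [← hu3, ← hv3]; group)
        rw [← (leftWord u * (leftWord v)⁻¹).injective.eq_iff, RelIso.apply_inv_self,
          hx t (by linarith)]
      · exact (leftWord_ne hu1 hv1 (fun t ht => hx t (by linarith))
          (by rw [← hu3, ← hv3]; group)).elim
      · have hy : leftWord u * (leftWord v)⁻¹ =
            leftGen i * (leftWord u' * (leftWord v')⁻¹) * (leftGen i)⁻¹ := by
          rw [hu3, hv3]; group
        rw [hy]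
        -- The conjugated element fixes everything from `j - 1` on, since `leftGen i` maps that half
        -- line into `[j, ∞)`. The gap grows by one, but the words get shorter.
        refine leftGen_conj_mem hji (ihn (e + 2) i (j - 1) u' v' (by omega)
          (by push_cast at hij ⊢; omega) hu1 hv1 fun t ht => ?_)
        push_cast at ht
        have h1 := hx (leftGen i t) (by
          rw [leftGen_apply]; split_ifs <;> linarith)
        rw [hy, RelIso.mul_apply, RelIso.inv_apply_self, RelIso.mul_apply] at h1
        exact (leftGen i).injective h1

/-- Conjugating by `leftGen 1` lowers any index at most `0` by one, so all of them come from
`leftGen 0`. -/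
theorem closure_leftGen_le :
    Subgroup.closure (Set.image leftGen (Set.Iic 1)) ≤ Subgroup.closure {leftGen 1, leftGen 0} := by
  have h1 : leftGen 1 ∈ Subgroup.closure {leftGen 1, leftGen 0} :=
    Subgroup.subset_closure (by simp)
  have hn : ∀ n : ℕ, leftGen (-n : ℤ) ∈ Subgroup.closure {leftGen 1, leftGen 0} := by
    intro n
    induction n with
    | zero => exact Subgroup.subset_closure (by simp)
    | succ n ih =>
      have := leftGen_mul (i := 1) (j := (-n : ℤ)) (by omega)
      rw [← inv_mul_eq_iff_eq_mul] at this
      have h2 : (-((n + 1 : ℕ) : ℤ)) = -n - 1 := by push_cast; ring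
      rw [h2, ← this]
      exact mul_mem (inv_mem h1) (mul_mem ih h1)
  rw [Subgroup.closure_le]
  rintro _ ⟨k, hk, rfl⟩
  rw [Set.mem_Iic] at hk
  rcases hk.lt_or_eq with h | rfl
  · have := hn (-k).toNat
    rwa [Int.toNat_of_nonneg (by omega), neg_neg] at this
  · exact h1

/-- The elements of `F` supported on `(-∞, 1]` form a group with two generators. -/
theorem mem_closure_of_mem_F {x : ℝ ≃o ℝ} (hx : x ∈ F) (hx' : x ∈ supportedIn (Set.Iic 1)) :
    x ∈ Subgroup.closure {leftGen 1, leftGen 0} := by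
  apply closure_leftGen_le
  obtain ⟨k, y, hy, rfl⟩ := exists_zpow_mul_of_mem_F hx
  obtain ⟨u, v, rfl⟩ := exists_leftWord_of_mem_closure hy
  obtain ⟨i, hi⟩ : ∃ i : ℤ, ∀ k ∈ u ++ v, k ≤ i := by
    obtain ⟨i, hi⟩ := (u ++ v).toFinset.exists_le
    exact ⟨i, fun k hk => hi k (by simpa using hk)⟩
  have hu : ∀ k ∈ u, k ≤ i := fun k hk => hi k (by simp [hk])
  have hv : ∀ k ∈ v, k ≤ i := fun k hk => hi k (by simp [hk])
  -- Only the power of `f₁` can move a point to the right of all supports.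
  have hk : k = 0 := by
    have h1 := mul_mem (leftWord_mem_supportedIn hu) (inv_mem (leftWord_mem_supportedIn hv))
      (max (i : ℝ) 1 + 1) (by simp [lt_add_of_le_of_pos])
    have h2 := hx' (max (i : ℝ) 1 + 1) (by simp)
    rw [RelIso.mul_apply, h1, f₁_zpow_apply] at h2
    have : (k : ℝ) = 0 := by linarith
    exact_mod_cast this
  subst hk
  rw [zpow_zero, one_mul] at hx' ⊢
  refine mem_closure_of_leftWord _ (i - 1).toNat i 1 u v le_rfl (by omega) hu hv fun t ht => ?_
  push_cast at ht
  rcases ht.lt_or_eq with h | rfl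
  · exact hx' t (by simpa using h)
  · set z := leftWord u * (leftWord v)⁻¹
    rcases lt_trichotomy (z 1) 1 with h | h | h
    · have h3 : 1 < z.symm ((z 1 + 1) / 2) := by rw [OrderIso.lt_symm_apply]; linarith
      have h4 := hx' _ (by simpa using h3)
      rw [OrderIso.apply_symm_apply] at h4
      linarith
    · exact h
    · have := z.injective (hx' (z 1) (by simpa using h))
      linarith

end Thompson

namespace Thompson

open scoped commutatorElement

/-! ### Spreads -/

theorem F₂_le_supportedIn : F₂ ≤ supportedIn (Set.Icc 0 1) := fun _ h => h.2

theorem F₂_apply_mem (a : F₂) {t : ℝ} (ht : t ∈ Set.Icc (0 : ℝ) 1) :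
    (a : ℝ ≃o ℝ) t ∈ Set.Icc (0 : ℝ) 1 :=
  apply_mem_of_supportedIn (F₂_le_supportedIn a.2) ht

theorem spread_apply (k₁ k₂ : ℤ) (a : F₂) (t : ℝ) :
    spread k₁ k₂ a t = if k₁ ≤ ⌊t⌋ ∧ ⌊t⌋ < k₂ then (a : ℝ ≃o ℝ) (t - ⌊t⌋) + ⌊t⌋ else t := rfl

theorem spread_apply_intCast (k₁ k₂ : ℤ) (a : F₂) (j : ℤ) : spread k₁ k₂ a j = j := by
  simp [spread_apply, F₂_zero]

theorem spread_apply_add {k₁ k₂ : ℤ} (a : F₂) {j : ℤ} (h₁ : k₁ ≤ j) (h₂ : j < k₂) {t : ℝ}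
    (ht : t ∈ Set.Icc (0 : ℝ) 1) : spread k₁ k₂ a (t + j) = (a : ℝ ≃o ℝ) t + j := by
  rcases ht.2.lt_or_eq with h | rfl
  · have : ⌊t + j⌋ = j := by
      rw [Int.floor_eq_iff]; constructor <;> linarith [ht.1]
    rw [spread_apply, this, if_pos ⟨h₁, h₂⟩, add_sub_cancel_right]
  · rw [F₂_one]
    have := spread_apply_intCast k₁ k₂ a (1 + j)
    push_cast at this
    exact this

theorem spread_apply_add_of_notMem {k₁ k₂ : ℤ} (a : F₂) {j : ℤ} (h : ¬(k₁ ≤ j ∧ j < k₂)) {t : ℝ}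
    (ht : t ∈ Set.Icc (0 : ℝ) 1) : spread k₁ k₂ a (t + j) = t + j := by
  rcases ht.2.lt_or_eq with h' | rfl
  · have : ⌊t + j⌋ = j := by
      rw [Int.floor_eq_iff]; constructor <;> linarith [ht.1]
    rw [spread_apply, this, if_neg h]
  · have := spread_apply_intCast k₁ k₂ a (1 + j)
    push_cast at this
    exact this

theorem spread_mem_supportedIn (k₁ k₂ : ℤ) (a : F₂) :
    spread k₁ k₂ a ∈ supportedIn (Set.Icc (k₁ : ℝ) k₂) := by
  intro t ht
  rw [spread_apply, if_neg]
  rintro ⟨h1, h2⟩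
  have h1 : (k₁ : ℝ) ≤ ⌊t⌋ := by exact_mod_cast h1
  have h2 : ((⌊t⌋ + 1 : ℤ) : ℝ) ≤ k₂ := by exact_mod_cast h2
  push_cast at h2
  exact ht ⟨by linarith [Int.floor_le t], by linarith [Int.lt_floor_add_one t]⟩

theorem f₁_conj_apply (a : ℝ ≃o ℝ) (j : ℤ) (t : ℝ) :
    (f₁ ^ j * a * (f₁ ^ j)⁻¹) t = a (t - j) + j := by
  rw [← zpow_neg, RelIso.mul_apply, RelIso.mul_apply, f₁_zpow_apply, f₁_zpow_apply]
  push_cast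
  rw [sub_eq_add_neg]

theorem spread_self (k : ℤ) (a : F₂) : spread k k a = 1 := by
  ext t
  rw [spread_apply, if_neg (by omega), RelIso.coe_one, id]

/-- Exhibits a spread as a product of conjugates of `a` by powers of `f₁`, the form in which its
membership in a subgroup is checked. -/
theorem spread_add_one {k₁ k₂ : ℤ} (h : k₁ ≤ k₂) (a : F₂) :
    spread k₁ (k₂ + 1) a = spread k₁ k₂ a * (f₁ ^ k₂ * a * (f₁ ^ k₂)⁻¹) := by
  ext t
  rw [RelIso.mul_apply, f₁_conj_apply]
  by_cases ht : ⌊t⌋ = k₂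
  · have hm : t - k₂ ∈ Set.Icc (0 : ℝ) 1 := by
      rw [← ht]
      exact ⟨by linarith [Int.floor_le t], by linarith [Int.lt_floor_add_one t]⟩
    rw [spread_apply_add_of_notMem a (by omega) (F₂_apply_mem a hm), spread_apply, ht,
      if_pos (by omega)]
  · have hm : (a : ℝ ≃o ℝ) (t - k₂) = t - k₂ := by
      by_cases h1 : t - k₂ ∈ Set.Icc (0 : ℝ) 1
      · rcases h1.2.lt_or_eq with h2 | h2
        · exact (ht (by rw [Int.floor_eq_iff]; constructor <;> linarith [h1.1])).elim
        · rw [h2, F₂_one]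
      · exact a.2.2 _ h1
    rw [hm, sub_add_cancel, spread_apply, spread_apply]
    congr 1
    rw [eq_iff_iff]
    constructor <;> rintro ⟨h1, h2⟩ <;> exact ⟨h1, by omega⟩

theorem spread_mem_of_conj_mem {H : Subgroup (ℝ ≃o ℝ)} {k : ℤ} {a : F₂}
    (h : ∀ j : ℤ, k ≤ j → f₁ ^ j * (a : ℝ ≃o ℝ) * (f₁ ^ j)⁻¹ ∈ H) (n : ℕ) :
    spread k (k + n) a ∈ H := by
  induction n with
  | zero => simp [spread_self]
  | succ n ih =>
    push_cast
    rw [← add_assoc, spread_add_one (by omega)]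
    exact mul_mem ih (h _ (by omega))

theorem spread_mem_F (k : ℤ) (n : ℕ) (a : F₂) : spread k (k + n) a ∈ F :=
  spread_mem_of_conj_mem (fun j _ => F.mul_mem (F.mul_mem (F.zpow_mem f₁_mem j) a.2.1)
    (F.inv_mem (F.zpow_mem f₁_mem j))) n

/-! ### Generation -/

theorem disjoint_Iic_Icc {r s t : ℝ} (h : r < s) : Disjoint (Set.Iic r) (Set.Icc s t) :=
  Set.disjoint_left.2 fun _ hx hx' => absurd (hx'.1.trans hx) (not_le.2 h)

/-- The elements supported on `(-∞, 1]` that lie in `K` up to an error supported on `[2, M]`. -/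
def approxIn (K : Subgroup (ℝ ≃o ℝ)) (M : ℝ) : Subgroup (ℝ ≃o ℝ) where
  carrier := {x | x ∈ supportedIn (Set.Iic 1) ∧ ∃ y ∈ supportedIn (Set.Icc 2 M), x * y ∈ K}
  one_mem' := ⟨one_mem _, 1, one_mem _, by simp⟩
  mul_mem' := by
    rintro x x' ⟨hx, y, hy, h⟩ ⟨hx', y', hy', h'⟩
    refine ⟨mul_mem hx hx', y * y', mul_mem hy hy', ?_⟩
    have hc : Commute x' y := commute_of_disjoint (disjoint_Iic_Icc (by norm_num)) hx' hy
    have : x * x' * (y * y') = x * y * (x' * y') := by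
      rw [mul_assoc, ← mul_assoc x', hc.eq]; group
    rw [this]
    exact mul_mem h h'
  inv_mem' := by
    rintro x ⟨hx, y, hy, h⟩
    refine ⟨inv_mem hx, y⁻¹, inv_mem hy, ?_⟩
    have hc : Commute x y := commute_of_disjoint (disjoint_Iic_Icc (by norm_num)) hx hy
    rw [← mul_inv_rev, ← hc.eq]
    exact inv_mem h

/-- Conjugation by `z` leaves `x'` alone and pushes its error beyond `M`. The two errors then
commute with each other and with `x`, `x'`, so they drop out of the commutator. -/
theorem commutator_mem_of_approxIn {K : Subgroup (ℝ ≃o ℝ)} {M : ℝ} {x x' z : ℝ ≃o ℝ}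
    (hx : x ∈ approxIn K M) (hx' : x' ∈ approxIn K M) (hz : z ∈ K)
    (hz' : z ∈ supportedIn (Set.Ioi 1)) (hz₂ : 2 ≤ z 2) (hzM : M < z 2) : ⁅x, x'⁆ ∈ K := by
  obtain ⟨hx, y, hy, h⟩ := hx
  obtain ⟨hx', y', hy', h'⟩ := hx'
  have hw : z * y' * z⁻¹ ∈ supportedIn (Set.Icc (z 2) (z M)) :=
    conj_mem_supportedIn hy' fun t ht => ⟨z.monotone ht.1, z.monotone ht.2⟩
  have hzx : Commute z x' := commute_of_disjoint (Set.Iic_disjoint_Ioi le_rfl).symm hz' hx'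
  have hK : x' * (z * y' * z⁻¹) ∈ K := by
    have : x' * (z * y' * z⁻¹) = z * (x' * y') * z⁻¹ := by
      rw [← mul_assoc, ← mul_assoc, ← hzx.eq]; group
    rw [this]
    exact mul_mem (mul_mem hz h') (inv_mem hz)
  generalize z * y' * z⁻¹ = w at hw hK
  have hxy : Commute x y := commute_of_disjoint (disjoint_Iic_Icc (by norm_num)) hx hy
  have hx'y : Commute x' y := commute_of_disjoint (disjoint_Iic_Icc (by norm_num)) hx' hy
  have hxw : Commute x w := commute_of_disjoint (disjoint_Iic_Icc (by linarith)) hx hw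
  have hx'w : Commute x' w := commute_of_disjoint (disjoint_Iic_Icc (by linarith)) hx' hw
  have hyw : Commute y w := commute_of_disjoint
    (Set.disjoint_left.2 fun t ht ht' => by linarith [ht.2, ht'.1]) hy hw
  have key : ⁅x * y, x' * w⁆ = ⁅x, x'⁆ := by
    have e1 : x * y * (x' * w) = x * x' * (y * w) := by
      rw [mul_assoc, ← mul_assoc y, ← hx'y.eq]; group
    have e2 : x' * w * (x * y) = x' * x * (y * w) := by
      rw [mul_assoc, ← mul_assoc w, ← hxw.eq, hyw.eq]; group
    have e3 : ∀ u v : ℝ ≃o ℝ, ⁅u, v⁆ = u * v * (v * u)⁻¹ := fun u v => by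
      rw [commutatorElement_def]; group
    rw [e3, e3, e1, e2]; group
  rw [← key, commutatorElement_def]
  exact mul_mem (mul_mem (mul_mem h hK) (inv_mem h)) (inv_mem hK)

section Generate

variable {m : ℤ} {n : ℕ} {a b : F₂} {K : Subgroup (ℝ ≃o ℝ)}

theorem mul_spread_apply_intCast (k₁ k₂ j : ℤ) (a : F₂) :
    (f₁ * spread k₁ k₂ a) j = j + 1 := by
  rw [RelIso.mul_apply, spread_apply_intCast, f₁_apply]

theorem f₂_mul_spread_apply_intCast (k₁ k₂ : ℤ) {j : ℤ} (hj : 1 ≤ j) (b : F₂) :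
    (f₂ * spread k₁ k₂ b) j = j + 1 := by
  rw [RelIso.mul_apply, spread_apply_intCast, f₂_apply_of_one_le (by exact_mod_cast hj)]

theorem f₂_mem_supportedIn : f₂ ∈ supportedIn (Set.Ioi 0) := by
  intro t ht
  rw [f₂_apply, if_pos (by simpa using ht)]

/-- The witnesses are `h⁻¹ * g` and its conjugate by `g⁻¹`. That conjugation shifts the error left
by one, to start at `m - 1`; this is where `3 ≤ m` is needed. -/
theorem leftGen_mem_approxIn (hm : 3 ≤ m) (hg : f₁ * spread m (m + n) a ∈ K)
    (hh : f₂ * spread m (m + n) b ∈ K) :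
    leftGen 1 ∈ approxIn K (m + n) ∧ leftGen 0 ∈ approxIn K (m + n) := by
  have hP := spread_mem_supportedIn m (m + n) a
  have hQ := spread_mem_supportedIn m (m + n) b
  set P := spread m (m + n) a
  set Q := spread m (m + n) b
  push_cast at hP hQ
  have hm' : (3 : ℝ) ≤ m := by exact_mod_cast hm
  have hd1 : leftGen 1 ∈ supportedIn (Set.Iic 1) := by simpa using leftGen_mem_supportedIn 1
  have hd0 : leftGen 0 ∈ supportedIn (Set.Iic 1) :=
    supportedIn_mono (Set.Iic_subset_Iic.2 (by norm_num)) (leftGen_mem_supportedIn 0)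
  have hR : Q⁻¹ * P ∈ supportedIn (Set.Icc (m : ℝ) (m + n)) := mul_mem (inv_mem hQ) hP
  have hQ1 : Commute (leftGen 1) Q⁻¹ :=
    commute_of_disjoint (disjoint_Iic_Icc (by linarith)) hd1 (inv_mem hQ)
  have hP0 : Commute (leftGen 0) P⁻¹ :=
    commute_of_disjoint (disjoint_Iic_Icc (by linarith)) hd0 (inv_mem hP)
  have h1 : leftGen 1 * (Q⁻¹ * P) = (f₂ * Q)⁻¹ * (f₁ * P) := by
    rw [← mul_assoc, hQ1.eq, ← f₂_inv_mul_f₁]; group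
  have h1K : leftGen 1 * (Q⁻¹ * P) ∈ K := by rw [h1]; exact mul_mem (inv_mem hh) hg
  have h10 : leftGen 0 = f₁⁻¹ * leftGen 1 * f₁ := by
    have := f₁_conj_leftGen 1 (-1)
    rw [zpow_neg, zpow_one, inv_inv] at this
    rw [this]; rfl
  have hsub : Set.Icc (m : ℝ) (m + n) ⊆ Set.Icc 2 (m + n) :=
    Set.Icc_subset_Icc_left (by linarith)
  refine ⟨⟨hd1, _, supportedIn_mono hsub hR, h1K⟩, hd0,
    P⁻¹ * (f₁⁻¹ * (Q⁻¹ * P) * f₁) * P, ?_, ?_⟩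
  · refine mul_mem (mul_mem (supportedIn_mono hsub (inv_mem hP)) ?_) (supportedIn_mono hsub hP)
    have := conj_mem_supportedIn (B := Set.Icc (2 : ℝ) (m + n)) (y := f₁⁻¹) hR fun t ht => ?_
    · rwa [inv_inv] at this
    · have := f₁_zpow_apply (-1) t
      rw [zpow_neg, zpow_one] at this
      rw [this]
      push_cast
      exact ⟨by linarith [ht.1], by linarith [ht.2]⟩
  · have : leftGen 0 * (P⁻¹ * (f₁⁻¹ * (Q⁻¹ * P) * f₁) * P) =
        (f₁ * P)⁻¹ * (leftGen 1 * (Q⁻¹ * P)) * (f₁ * P) := by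
      rw [← mul_assoc, ← mul_assoc, hP0.eq, h10]; group
    rw [this]
    exact mul_mem (mul_mem (inv_mem hg) h1K) hg

theorem pow_apply_two {z : ℝ ≃o ℝ} (hz : ∀ j : ℤ, 2 ≤ j → z j = j + 1) (k : ℕ) :
    (z ^ k) 2 = 2 + k := by
  induction k with
  | zero => simp
  | succ k ih =>
    rw [pow_succ', RelIso.mul_apply, ih]
    have := hz (2 + k) (by omega)
    push_cast at this ⊢
    rw [this]; ring

theorem commutator_F₂_le (hm : 3 ≤ m) (hg : f₁ * spread m (m + n) a ∈ K)
    (hh : f₂ * spread m (m + n) b ∈ K) {x : F₂} (hx : x ∈ commutator F₂) :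
    (x : ℝ ≃o ℝ) ∈ K := by
  obtain ⟨h1, h0⟩ := leftGen_mem_approxIn hm hg hh
  have happ : ∀ x : F₂, (x : ℝ ≃o ℝ) ∈ approxIn K (m + n) := by
    intro x
    refine (Subgroup.closure_le _).2 ?_ (mem_closure_of_mem_F x.2.1
      (supportedIn_mono Set.Icc_subset_Iic_self (F₂_le_supportedIn x.2)))
    rintro _ (rfl | rfl)
    exacts [h1, h0]
  set g := f₁ * spread m (m + n) a with hgdef
  set h := f₂ * spread m (m + n) b with hhdef
  have hm' : (3 : ℝ) ≤ m := by exact_mod_cast hm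
  have hsupp : h ∈ supportedIn (Set.Ioi 0) := by
    refine mul_mem f₂_mem_supportedIn (supportedIn_mono ?_ (spread_mem_supportedIn _ _ _))
    exact fun t ht => lt_of_lt_of_le (by linarith) ht.1
  have hg0 : g 0 = 1 := by
    have := mul_spread_apply_intCast m (m + n) 0 a
    push_cast at this
    rw [hgdef, this]; norm_num
  have hz : g * h * g⁻¹ ∈ supportedIn (Set.Ioi 1) := by
    refine conj_mem_supportedIn hsupp fun t ht => ?_
    rw [Set.mem_Ioi, ← hg0]
    exact g.strictMono ht
  have hz2 : ∀ j : ℤ, 2 ≤ j → (g * h * g⁻¹) j = j + 1 := by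
    intro j hj
    have e1 : g⁻¹ j = ((j - 1 : ℤ) : ℝ) := by
      rw [← g.injective.eq_iff, RelIso.apply_inv_self, hgdef, mul_spread_apply_intCast]
      push_cast; ring
    rw [RelIso.mul_apply, RelIso.mul_apply, e1, hhdef,
      f₂_mul_spread_apply_intCast _ _ (by omega)]
    have := mul_spread_apply_intCast m (m + n) j a
    push_cast
    rw [sub_add_cancel]
    exact this
  -- The pushing element is a power of `g * h * g⁻¹`. The exponent `m + n` sends `2` to `2 + m + n`,
  -- beyond the right end of the errors.
  have hzpow := pow_apply_two hz2 (m.toNat + n)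
  have hmn : ((m.toNat : ℕ) : ℝ) = m := by
    have : ((m.toNat : ℕ) : ℤ) = m := Int.toNat_of_nonneg (by omega)
    exact_mod_cast this
  have hle : commutator F₂ ≤ K.comap F₂.subtype := by
    rw [commutator_def, Subgroup.commutator_le]
    intro x _ y _
    rw [Subgroup.mem_comap, map_commutatorElement]
    refine commutator_mem_of_approxIn (happ x) (happ y)
      (pow_mem (mul_mem (mul_mem hg hh) (inv_mem hg)) (m.toNat + n)) (pow_mem hz _) ?_ ?_ <;>
    · rw [hzpow]
      push_cast
      rw [hmn]
      have : (0 : ℝ) ≤ n := n.cast_nonneg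
      linarith
  exact hle hx

/-! ### Recovering `f₁` and `f₂` -/

/-- On `[0, 1]`, the powers of `f₁ * spread k₁ k₂ a` are translates of powers of `a`. -/
theorem exists_pow_mul_spread_apply (k₁ k₂ : ℤ) (a : F₂) (j : ℕ) :
    ∃ c : ℕ, ∀ t ∈ Set.Icc (0 : ℝ) 1,
      ((f₁ * spread k₁ k₂ a) ^ j) t = ((a ^ c : F₂) : ℝ ≃o ℝ) t + j := by
  induction j with
  | zero => exact ⟨0, fun t _ => by simp⟩
  | succ j ih =>
    obtain ⟨c, hc⟩ := ih
    by_cases h : k₁ ≤ (j : ℤ) ∧ (j : ℤ) < k₂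
    · refine ⟨c + 1, fun t ht => ?_⟩
      have := spread_apply_add a h.1 h.2 (F₂_apply_mem (a ^ c) ht)
      rw [Int.cast_natCast] at this
      rw [pow_succ', RelIso.mul_apply, RelIso.mul_apply, hc t ht, this, f₁_apply, pow_succ' a,
        Subgroup.coe_mul, RelIso.mul_apply]
      push_cast; ring
    · refine ⟨c, fun t ht => ?_⟩
      have := spread_apply_add_of_notMem a h (F₂_apply_mem (a ^ c) ht)
      rw [Int.cast_natCast] at this
      rw [pow_succ', RelIso.mul_apply, RelIso.mul_apply, hc t ht, this, f₁_apply]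
      push_cast; ring

/-- The power and `f₁ ^ j` differ on `[0, 1]` only by a power of `a`, which commutes with `a`. So
conjugates of `a` by `f₁ ^ j` are available before `f₁` itself is. -/
theorem pow_conj_eq (k₁ k₂ : ℤ) (a : F₂) (j : ℕ) :
    (f₁ * spread k₁ k₂ a) ^ j * (a : ℝ ≃o ℝ) * ((f₁ * spread k₁ k₂ a) ^ j)⁻¹ =
      f₁ ^ (j : ℤ) * (a : ℝ ≃o ℝ) * (f₁ ^ (j : ℤ))⁻¹ := by
  obtain ⟨c, hc⟩ := exists_pow_mul_spread_apply k₁ k₂ a j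
  set G := (f₁ * spread k₁ k₂ a) ^ j
  have hG0 := hc 0 (by simp)
  have hG1 := hc 1 (by simp)
  rw [F₂_zero] at hG0
  rw [F₂_one] at hG1
  rw [mul_inv_eq_iff_eq_mul]
  ext t
  rw [RelIso.mul_apply, RelIso.mul_apply _ G, f₁_conj_apply]
  by_cases ht : t ∈ Set.Icc (0 : ℝ) 1
  · rw [hc t ht, hc _ (F₂_apply_mem a ht), Int.cast_natCast, add_sub_cancel_right,
      ← RelIso.mul_apply, ← RelIso.mul_apply, ← Subgroup.coe_mul, ← Subgroup.coe_mul, ← pow_succ,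
      ← pow_succ']
  · have : G t - j ∉ Set.Icc (0 : ℝ) 1 := by
      rintro ⟨h0, h1⟩
      refine ht ⟨?_, ?_⟩ <;> rw [← G.le_iff_le]
      · rw [hG0]; linarith
      · rw [hG1]; linarith
    rw [a.2.2 t ht, Int.cast_natCast, a.2.2 _ this, sub_add_cancel]

/-- The order matters: `a` gives the first spread and thus `f₁`; only then do conjugates of `b` by
powers of `f₁` give the second spread and `f₂`. -/
theorem F_le_of_mem (hm : 3 ≤ m) (ha : a ∈ commutator F₂) (hb : b ∈ commutator F₂)
    (hg : f₁ * spread m (m + n) a ∈ K) (hh : f₂ * spread m (m + n) b ∈ K) : F ≤ K := by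
  have haK := commutator_F₂_le hm hg hh ha
  have hbK := commutator_F₂_le hm hg hh hb
  have hP : spread m (m + n) a ∈ K := by
    refine spread_mem_of_conj_mem (fun j hj => ?_) n
    have := pow_conj_eq m (m + n) a j.toNat
    rw [Int.toNat_of_nonneg (by omega)] at this
    rw [← this]
    exact mul_mem (mul_mem (pow_mem hg _) haK) (inv_mem (pow_mem hg _))
  have hf₁ : f₁ ∈ K := (Subgroup.mul_mem_cancel_right _ hP).1 hg
  have hQ : spread m (m + n) b ∈ K := spread_mem_of_conj_mem (fun j _ =>
    mul_mem (mul_mem (zpow_mem hf₁ _) hbK) (inv_mem (zpow_mem hf₁ _))) n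
  have hf₂ : f₂ ∈ K := (Subgroup.mul_mem_cancel_right _ hQ).1 hh
  rw [F, Subgroup.closure_le]
  rintro _ (rfl | rfl)
  exacts [hf₁, hf₂]

end Generate

end Thompson

/-! ### Balls of the free group -/

section FreeBalls

variable {k : ℕ} {G H : Type} [Group G] [Group H]

theorem wordEval_cons (S : Fin k → G) (x : Fin k × Bool) (w : List (Fin k × Bool)) :
    wordEval S (x :: w) = cond x.2 (S x.1) (S x.1)⁻¹ * wordEval S w := by
  simp [wordEval]

theorem wordEval_append (S : Fin k → G) (w w' : List (Fin k × Bool)) :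
    wordEval S (w ++ w') = wordEval S w * wordEval S w' := by
  simp [wordEval]

theorem wordEval_invRev (S : Fin k → G) (w : List (Fin k × Bool)) :
    wordEval S (FreeGroup.invRev w) = (wordEval S w)⁻¹ := by
  rw [wordEval_eq_lift, wordEval_eq_lift, ← FreeGroup.inv_mk, map_inv]

theorem wordEval_of (w : List (Fin k × Bool)) :
    wordEval (FreeGroup.of : Fin k → FreeGroup (Fin k)) w = FreeGroup.mk w := by
  rw [wordEval_eq_lift, FreeGroup.lift_of_eq_id, MonoidHom.id_apply]

theorem map_wordEval (f : G →* H) (S : Fin k → G) (w : List (Fin k × Bool)) :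
    f (wordEval S w) = wordEval (fun i => f (S i)) w := by
  induction w with
  | nil => simp [wordEval]
  | cons x w ih =>
    obtain ⟨i, b⟩ := x
    cases b <;> simp [wordEval_cons, ih]

/-- A word of length at most `2 n + 1` that is a relation in a marked group whose `n`-ball is that
of the free group is trivial. -/
theorem BallIso.mk_eq_one {S : Fin k → G} {n : ℕ}
    (h : BallIso S (FreeGroup.of : Fin k → FreeGroup (Fin k)) n) {w : List (Fin k × Bool)}
    (hw : w.length ≤ 2 * n + 1) (hw1 : wordEval S w = 1) : FreeGroup.mk w = 1 := by
  rw [ballIso_iff] at h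
  rw [← wordEval_of]
  rcases le_or_gt w.length n with hn | hn
  · have := (h w [] hn (by simp)).1.1 (by rw [hw1]; rfl)
    rw [this]; rfl
  · obtain ⟨x, v, hv⟩ : ∃ x v, w.drop n = x :: v :=
      List.exists_cons_of_ne_nil (by simpa using hn)
    have hw' : w = w.take n ++ x :: v := by rw [← hv, List.take_append_drop]
    have hu : (w.take n).length ≤ n := by simp
    have hvl : v.length ≤ n := by
      have := congrArg List.length hv
      simp only [List.length_drop, List.length_cons] at this
      omega
    generalize w.take n = u at hw' hu
    obtain ⟨i, b⟩ := x
    have hvl' : (FreeGroup.invRev v).length ≤ n := by simpa using hvl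
    rw [hw', wordEval_append, wordEval_cons] at hw1 ⊢
    cases b with
    | true =>
      simp only [cond_true, ← mul_assoc] at hw1 ⊢
      rw [mul_eq_one_iff_eq_inv] at hw1 ⊢
      rw [← wordEval_invRev] at hw1 ⊢
      exact ((h _ _ hvl' hu).2 i |>.1 hw1.symm).symm
    | false =>
      simp only [cond_false] at hw1 ⊢
      rw [mul_eq_one_iff_eq_inv, mul_inv_rev, inv_inv] at hw1 ⊢
      rw [← wordEval_invRev] at hw1 ⊢
      exact (h _ _ hu hvl').2 i |>.1 hw1

theorem ballIso_of_mk_eq_one {S : Fin k → G} {n : ℕ}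
    (h : ∀ w : List (Fin k × Bool), w.length ≤ 2 * n + 1 → wordEval S w = 1 →
      FreeGroup.mk w = 1) :
    BallIso S (FreeGroup.of : Fin k → FreeGroup (Fin k)) n := by
  have hmap : ∀ w, wordEval S w = FreeGroup.lift S (wordEval FreeGroup.of w) := fun w => by
    rw [wordEval_of, wordEval_eq_lift]
  rw [ballIso_iff]
  refine fun w v hw hv => ⟨⟨fun e => ?_, fun e => by rw [hmap, hmap, e]⟩,
    fun i => ⟨fun e => ?_, fun e => by rw [hmap, hmap, e]; simp⟩⟩
  · have := h (w ++ FreeGroup.invRev v) (by simp; omega)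
      (by rw [wordEval_append, wordEval_invRev, e, mul_inv_cancel])
    rwa [← wordEval_of, wordEval_append, wordEval_invRev, mul_inv_eq_one] at this
  · have := h (FreeGroup.invRev w ++ (v ++ [(i, true)])) (by simp; omega)
      (by rw [wordEval_append, wordEval_invRev, wordEval_snoc, e]; simp)
    rw [← wordEval_of, wordEval_append, wordEval_invRev, wordEval_snoc, inv_mul_eq_one] at this
    exact this

end FreeBalls

/-! ### Words acting on the window of the spreads -/

namespace Thompson

/-- A word in `f₁ * spread k₁ k₂ a` and `f₂ * spread k₁ k₂ b` acts on the intervals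
`[j, j + 1]` as the same word in `a` and `b`, followed by a translation, as long as the
interval stays in `[k₁, k₂]`. -/
theorem exists_wordEval_spread_apply {k₁ k₂ : ℤ} (hk : 1 ≤ k₁) (a b : F₂)
    (w : List (Fin 2 × Bool)) :
    ∃ lo e hi : ℤ, lo ≤ 0 ∧ 0 ≤ hi ∧ lo ≤ e ∧ e ≤ hi ∧ hi - lo ≤ w.length ∧
      ∀ j : ℤ, k₁ ≤ j + lo → j + hi ≤ k₂ → ∀ t ∈ Set.Icc (0 : ℝ) 1,
        wordEval ![f₁ * spread k₁ k₂ a, f₂ * spread k₁ k₂ b] w (t + j) =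
          ((wordEval ![a, b] w : F₂) : ℝ ≃o ℝ) t + (j + e : ℤ) := by
  induction w with
  | nil => exact ⟨0, 0, 0, le_rfl, le_rfl, le_rfl, le_rfl, by simp, by simp [wordEval]⟩
  | cons x w ih =>
    obtain ⟨lo, e, hi, h1, h2, h3, h4, h5, ih⟩ := ih
    obtain ⟨i, s⟩ := x
    have hup : ∀ j : ℤ, k₁ ≤ j → j < k₂ → ∀ t ∈ Set.Icc (0 : ℝ) 1,
        (![f₁ * spread k₁ k₂ a, f₂ * spread k₁ k₂ b] i) (t + j) =
          ((![a, b] i : F₂) : ℝ ≃o ℝ) t + (j + 1 : ℤ) := by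
      intro j hj hj' t ht
      have hj1 : (1 : ℝ) ≤ j := by exact_mod_cast hk.trans hj
      fin_cases i
      · simp [spread_apply_add a hj hj' ht, f₁_apply, add_assoc]
      · have : (1 : ℝ) ≤ (b : ℝ ≃o ℝ) t + j := by linarith [(F₂_apply_mem b ht).1]
        simp [spread_apply_add b hj hj' ht, f₂_apply_of_one_le this, add_assoc]
    cases s with
    | true =>
      refine ⟨lo, e + 1, max hi (e + 1), h1, by omega, by omega, by omega,
        by simp only [List.length_cons]; push_cast; omega, fun j hlo hhi t ht => ?_⟩
      have := hup (j + e) (by omega) (by omega) _ (F₂_apply_mem (wordEval ![a, b] w) ht)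
      rw [wordEval_cons, wordEval_cons, RelIso.mul_apply, ih j hlo (by omega) t ht, cond_true,
        this, cond_true, Subgroup.coe_mul, RelIso.mul_apply, add_assoc j e 1]
    | false =>
      -- An inverse letter undoes the step out of the interval one unit lower, so that interval must
      -- lie in the window.
      refine ⟨min lo (e - 1), e - 1, hi, by omega, by omega, by omega, by omega,
        by simp only [List.length_cons]; push_cast; omega, fun j hlo hhi t ht => ?_⟩
      have := hup (j + (e - 1)) (by omega) (by omega) _
        (F₂_apply_mem ((![a, b] i)⁻¹ * wordEval ![a, b] w) ht)
      rw [wordEval_cons, wordEval_cons, RelIso.mul_apply, ih j (by omega) hhi t ht, cond_false,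
        cond_false, ← (![f₁ * spread k₁ k₂ a, f₂ * spread k₁ k₂ b] i).injective.eq_iff,
        RelIso.apply_inv_self, this, ← RelIso.mul_apply, ← Subgroup.coe_mul, mul_inv_cancel_left,
        add_assoc j, sub_add_cancel]

theorem mk_eq_one_of_wordEval_spread {m : ℤ} (hm : 1 ≤ m) {n : ℕ} {a b : F₂}
    (h : BallIso ![a, b] (FreeGroup.of : Fin 2 → FreeGroup (Fin 2)) n)
    {w : List (Fin 2 × Bool)} (hw : w.length ≤ 2 * n + 1)
    (hw1 : wordEval ![f₁ * spread m (m + 2 * n + 1) a, f₂ * spread m (m + 2 * n + 1) b] w = 1) :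
    FreeGroup.mk w = 1 := by
  obtain ⟨lo, e, hi, h1, h2, h3, h4, h5, hact⟩ :=
    exists_wordEval_spread_apply (k₂ := m + 2 * n + 1) hm a b w
  -- Starting at `m - lo`, the lowest interval reached begins at `m`, and the total excursion fits
  -- in the `2 n + 1` units of the window.
  have key := hact (m - lo) (by omega) (by omega)
  rw [hw1] at key
  have he : e = 0 := by
    have := key 0 (by simp)
    rw [F₂_zero] at this
    simp only [RelIso.coe_one, id] at this
    push_cast at this
    have : (e : ℝ) = 0 := by linarith
    exact_mod_cast this
  subst he
  refine h.mk_eq_one hw (Subtype.ext ?_)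
  ext t
  by_cases ht : t ∈ Set.Icc (0 : ℝ) 1
  · have := key t ht
    simp only [RelIso.coe_one, id, add_zero] at this
    have : t = ((wordEval ![a, b] w : F₂) : ℝ ≃o ℝ) t := by linarith
    rw [← this]; rfl
  · exact (wordEval ![a, b] w).2.2 t ht

end Thompson

namespace Thompson

open scoped commutatorElement

/-! ### Bumps -/

/-- An element of `F` supported on `(j, i)` that is `t ↦ t + 1` on `[j + 1, i - 2]`. -/
noncomputable def bump (j i : ℤ) : ℝ ≃o ℝ :=
  f₁ ^ j * f₂ * (f₁ ^ j)⁻¹ * f₁ ^ (-1 : ℤ) * leftGen i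

theorem bump_mem (j i : ℤ) : bump j i ∈ F :=
  mul_mem (mul_mem (mul_mem (mul_mem (zpow_mem f₁_mem _) f₂_mem) (inv_mem (zpow_mem f₁_mem _)))
    (zpow_mem f₁_mem _)) (leftGen_mem _)

theorem bump_apply (j i : ℤ) (t : ℝ) : bump j i t = f₂ (leftGen i t - 1 - j) + j := by
  rw [bump, RelIso.mul_apply, RelIso.mul_apply, f₁_conj_apply, f₁_zpow_apply]
  push_cast
  rw [← sub_eq_add_neg]

theorem bump_mem_supportedIn {j i : ℤ} (h : j + 3 ≤ i) :
    bump j i ∈ supportedIn (Set.Ioo (j : ℝ) i) := by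
  intro t ht
  have h' : (j : ℝ) + 3 ≤ i := by exact_mod_cast h
  rw [Set.mem_Ioo, not_and_or, not_lt, not_lt] at ht
  rw [bump_apply, leftGen_apply, f₂_apply]
  rcases ht with ht | ht <;> split_ifs <;> linarith

theorem bump_apply_of_mem {j i : ℤ} {t : ℝ} (h1 : (j : ℝ) + 1 ≤ t) (h2 : t ≤ i - 2) :
    bump j i t = t + 1 := by
  rw [bump_apply, leftGen_apply, if_pos h2, f₂_apply_of_one_le (by linarith)]
  ring

theorem bump_pow_apply {j i : ℤ} {t : ℝ} (h1 : (j : ℝ) + 1 ≤ t) (k : ℕ) (h2 : t + k ≤ i - 1) :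
    (bump j i ^ k) t = t + k := by
  induction k with
  | zero => simp
  | succ k ih =>
    push_cast at h2 ⊢
    have : (0 : ℝ) ≤ k := k.cast_nonneg
    rw [pow_succ', RelIso.mul_apply, ih (by linarith),
      bump_apply_of_mem (by linarith) (by linarith)]
    ring

/-- An element of `F` supported on `(4 r, 4 r + 8)` that maps `4 r + 1` to `4 r + 5`. -/
noncomputable def block (r : ℤ) : ℝ ≃o ℝ := bump (4 * r) (4 * r + 8) ^ 4

theorem block_mem (r : ℤ) : block r ∈ F := pow_mem (bump_mem _ _) _

theorem block_mem_supportedIn (r : ℤ) :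
    block r ∈ supportedIn (Set.Ioo (4 * r : ℝ) (4 * r + 8)) := by
  have := bump_mem_supportedIn (j := 4 * r) (i := 4 * r + 8) (by omega)
  push_cast at this
  exact pow_mem this _

/-- The image lies in the domain of this same statement both for `r` and for `r + 1`: a run may
repeat its block, and the next run may then take over. -/
theorem block_apply_mem {r : ℤ} {t : ℝ} (ht : t ∈ Set.Ico (4 * r + 1 : ℝ) (4 * r + 8)) :
    block r t ∈ Set.Ico (4 * r + 5 : ℝ) (4 * r + 8) := by
  have h1 : block r (4 * r + 1) = 4 * r + 5 := by
    rw [block, bump_pow_apply] <;> push_cast <;> linarith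
  refine ⟨?_, (apply_mem_of_supportedIn (block_mem_supportedIn r) ⟨?_, ht.2⟩).2⟩
  · rw [← h1]; exact (block r).monotone ht.1
  · linarith [ht.1]

/-! ### Words moving a point along a chain of blocks -/

variable {k : ℕ}

/-- The inverses of the successive letters of the list act on the successive overlapping intervals
`(4 r, 4 r + 8)`, `(4 r + 4, 4 r + 12)`, … as the corresponding blocks. -/
def Follows (S : Fin k → ℝ ≃o ℝ) : ℤ → List (Fin k × Bool) → Prop
  | _, [] => True
  | r, x :: L => (∀ t ∈ Set.Ioo (4 * r : ℝ) (4 * r + 8),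
      (cond x.2 (S x.1) (S x.1)⁻¹)⁻¹ t = block r t) ∧ Follows S (r + 1) L

theorem Follows.congr {S T : Fin k → ℝ ≃o ℝ} {L : List (Fin k × Bool)} {r : ℤ}
    (h : Follows S r L)
    (hST : ∀ i, ∀ t : ℝ, 4 * r < t → T i t = S i t ∧ (T i)⁻¹ t = (S i)⁻¹ t) :
    Follows T r L := by
  induction L generalizing r with
  | nil => trivial
  | cons x L ih =>
    refine ⟨fun t ht => ?_, ih h.2 fun i t ht => hST i t ?_⟩
    · rw [← h.1 t ht]
      obtain ⟨i, b⟩ := x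
      cases b
      · simpa using (hST i t ht.1).1
      · exact (hST i t ht.1).2
    · push_cast at ht; linarith

/-- Every reduced word moves a point if the letters follow the list of runs of the word. -/
theorem exists_runs (x : Fin k × Bool) (w : List (Fin k × Bool))
    (hw : FreeGroup.IsReduced (x :: w)) :
    ∃ L : List (Fin k × Bool), (x :: L).IsChain (fun y z => y.1 ≠ z.1) ∧
      ∀ (S : Fin k → ℝ ≃o ℝ) (r : ℤ), Follows S r (x :: L) →
        ∀ t ∈ Set.Ico (4 * r + 1 : ℝ) (4 * r + 8),
          (4 * r + 5 : ℝ) ≤ (wordEval S (x :: w))⁻¹ t := by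
  induction w generalizing x with
  | nil =>
    refine ⟨[], by simp, fun S r h t ht => ?_⟩
    have : wordEval S [x] = cond x.2 (S x.1) (S x.1)⁻¹ := by simp [wordEval]
    rw [this, h.1 t ⟨by linarith [ht.1], ht.2⟩]
    exact (block_apply_mem ht).1
  | cons y w ih =>
    have hw' := List.isChain_cons_cons.1 hw
    obtain ⟨L, hL, hact⟩ := ih y hw'.2
    by_cases hxy : x.1 = y.1
    -- In a reduced word adjacent letters with equal index also have equal sign, so the run and its
    -- block continue.
    · have hxy' : x = y := Prod.ext hxy (hw'.1 hxy)
      subst hxy'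
      refine ⟨L, hL, fun S r h t ht => ?_⟩
      have hb := block_apply_mem ht
      rw [wordEval_cons, mul_inv_rev, RelIso.mul_apply, h.1 t ⟨by linarith [ht.1], ht.2⟩]
      exact hact S r h _ ⟨by linarith [hb.1], hb.2⟩
    · refine ⟨y :: L, List.isChain_cons_cons.2 ⟨hxy, hL⟩, fun S r h t ht => ?_⟩
      have hb := block_apply_mem ht
      rw [wordEval_cons, mul_inv_rev, RelIso.mul_apply, h.1 t ⟨by linarith [ht.1], ht.2⟩]
      have := hact S (r + 1) h.2 (block r t) (by
        push_cast
        exact ⟨by linarith [hb.1], by linarith [hb.2]⟩)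
      push_cast at this
      linarith

/-- The block of index `r` or its inverse, according to the sign. -/
noncomputable def signedBlock (r : ℤ) (s : Bool) : ℝ ≃o ℝ := cond s (block r)⁻¹ (block r)

theorem signedBlock_mem (r : ℤ) (s : Bool) : signedBlock r s ∈ F := by
  cases s
  exacts [block_mem r, inv_mem (block_mem r)]

theorem signedBlock_mem_supportedIn (r : ℤ) (s : Bool) :
    signedBlock r s ∈ supportedIn (Set.Ioo (4 * r : ℝ) (4 * r + 8)) := by
  cases s
  exacts [block_mem_supportedIn r, inv_mem (block_mem_supportedIn r)]

theorem cond_signedBlock_inv (r : ℤ) (s : Bool) :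
    (cond s (signedBlock r s) (signedBlock r s)⁻¹)⁻¹ = block r := by
  cases s <;> simp [signedBlock]

/-- Each generator is a product of the signed blocks of its runs. Consecutive runs have different
indices and only consecutive blocks overlap, so these factors have disjoint supports. The sharper
support bound for `i ≠ x.1` carries this disjointness through the induction. -/
theorem exists_follows (L : List (Fin k × Bool)) (x : Fin k × Bool) (r : ℤ)
    (hL : (x :: L).IsChain (fun y z => y.1 ≠ z.1)) :
    ∃ S : Fin k → ℝ ≃o ℝ, (∀ i, S i ∈ F) ∧
      (∀ i, S i ∈ supportedIn (Set.Ioo (4 * r : ℝ) (4 * r + 4 * L.length + 8))) ∧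
      (∀ i, i ≠ x.1 → S i ∈ supportedIn (Set.Ioo (4 * r + 4 : ℝ) (4 * r + 4 * L.length + 8))) ∧
      Follows S r (x :: L) := by
  induction L generalizing x r with
  | nil =>
    refine ⟨fun i => if i = x.1 then signedBlock r x.2 else 1, fun i => ?_, fun i => ?_,
      fun i hi => ?_, fun t _ => ?_, trivial⟩
    · dsimp only
      split_ifs
      exacts [signedBlock_mem _ _, one_mem _]
    · dsimp only
      split_ifs
      · simpa using signedBlock_mem_supportedIn r x.2
      · exact one_mem _
    · dsimp only
      rw [if_neg hi]
      exact one_mem _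
    · simp only [if_true]
      rw [cond_signedBlock_inv]
  | cons y L ih =>
    rw [List.isChain_cons_cons] at hL
    obtain ⟨S, hSF, hS, hS', hf⟩ := ih y (r + 1) hL.2
    have hD : (4 * (r + 1 : ℤ) : ℝ) + 4 * L.length + 8 = 4 * r + 4 * (y :: L).length + 8 := by
      push_cast [List.length_cons]; ring
    rw [hD] at hS hS'
    set D : ℝ := 4 * r + 4 * (y :: L).length + 8 with hDdef
    have hDr : (4 * r + 8 : ℝ) ≤ D := by
      have : (0 : ℝ) ≤ (y :: L).length := Nat.cast_nonneg _
      linarith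
    push_cast at hS hS'
    have hb := signedBlock_mem_supportedIn r x.2
    have hSx : S x.1 ∈ supportedIn (Set.Ioo (4 * r + 8 : ℝ) D) :=
      supportedIn_mono (Set.Ioo_subset_Ioo_left (by linarith)) (hS' x.1 hL.1)
    have hcomm : Commute (signedBlock r x.2) (S x.1) := commute_of_disjoint
      (Set.disjoint_left.2 fun t ht ht' => by linarith [ht.2, ht'.1]) hb hSx
    have hS4 : ∀ i, S i ∈ supportedIn (Set.Ioo (4 * r + 4 : ℝ) D) := fun i =>
      supportedIn_mono (Set.Ioo_subset_Ioo_left (by linarith)) (hS i)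
    refine ⟨fun i => if i = x.1 then signedBlock r x.2 * S i else S i, fun i => ?_, fun i => ?_,
      fun i hi => ?_, fun t ht => ?_, fun t ht => ?_, ?_⟩
    · dsimp only
      split_ifs
      exacts [mul_mem (signedBlock_mem _ _) (hSF i), hSF i]
    · have h2 : S i ∈ supportedIn (Set.Ioo (4 * r : ℝ) D) :=
        supportedIn_mono (Set.Ioo_subset_Ioo_left (by linarith)) (hS4 i)
      dsimp only
      split_ifs
      exacts [mul_mem (supportedIn_mono (Set.Ioo_subset_Ioo_right hDr) hb) h2, h2]
    · dsimp only
      rw [if_neg hi]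
      exact hS4 i
    · simp only [if_true]
      have h1 : ∀ z ∈ supportedIn (Set.Ioo (4 * r + 8 : ℝ) D), z t = t := fun z hz =>
        hz t fun h => by linarith [h.1, ht.2]
      rw [← cond_signedBlock_inv r x.2]
      generalize x.2 = s at hcomm
      cases s with
      | false =>
        simp only [cond_false, inv_inv]
        rw [RelIso.mul_apply, h1 _ hSx]
      | true =>
        simp only [cond_true]
        rw [hcomm.eq, mul_inv_rev, RelIso.mul_apply, h1 _ (inv_mem hSx)]
    · rw [← hf.1 t ht]
      simp only [if_neg (Ne.symm hL.1)]
    · refine hf.2.congr fun i t ht => ?_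
      split_ifs with hi
      · subst hi
        have h1 : ∀ z ∈ supportedIn (Set.Ioo (4 * r : ℝ) (4 * r + 8)), z t = t := fun z hz =>
          hz t fun h => by push_cast at ht; linarith [h.2]
        constructor
        · rw [hcomm.eq, RelIso.mul_apply, h1 _ hb]
        · rw [mul_inv_rev, RelIso.mul_apply, h1 _ (inv_mem hb)]
      · exact ⟨rfl, rfl⟩

/-! ### Pairs without short relations -/

theorem wordEval_mem_of_forall_mem {G : Type} [Group G] {H : Subgroup G} {S : Fin k → G}
    (hS : ∀ i, S i ∈ H) (w : List (Fin k × Bool)) : wordEval S w ∈ H := by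
  refine Subgroup.list_prod_mem _ fun x hx => ?_
  obtain ⟨⟨i, b⟩, _, rfl⟩ := List.mem_map.1 hx
  cases b
  exacts [inv_mem (hS i), hS i]

theorem wordEval_mul_of_commute {G : Type} [Group G] {S T : Fin k → G}
    (h : ∀ i j, Commute (S i) (T j)) (w : List (Fin k × Bool)) :
    wordEval (fun i => S i * T i) w = wordEval S w * wordEval T w := by
  induction w with
  | nil => simp [wordEval]
  | cons x w ih =>
    have hc : ∀ j, Commute (wordEval S w) (T j) := fun j => by
      have := wordEval_mem_of_forall_mem (H := Subgroup.centralizer {T j}) (S := S)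
        (fun i => by
          rw [Subgroup.mem_centralizer_singleton_iff]; exact (h i j).eq) w
      rw [Subgroup.mem_centralizer_singleton_iff] at this
      exact this
    obtain ⟨i, b⟩ := x
    rw [wordEval_cons, wordEval_cons, wordEval_cons, ih]
    cases b with
    | true =>
      simp only [cond_true]
      rw [mul_assoc, ← mul_assoc (T i), ← (hc i).eq]; group
    | false =>
      simp only [cond_false]
      rw [(h i i).eq, mul_inv_rev, mul_assoc, ← mul_assoc (T i)⁻¹, ← ((hc i).inv_right).eq]; group

theorem wordEval_eq_one_of_mul {A B : Set ℝ} (hAB : Disjoint A B) {S T : Fin k → ℝ ≃o ℝ}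
    (hS : ∀ i, S i ∈ supportedIn A) (hT : ∀ i, T i ∈ supportedIn B) {w : List (Fin k × Bool)}
    (h : wordEval (fun i => S i * T i) w = 1) : wordEval S w = 1 ∧ wordEval T w = 1 := by
  rw [wordEval_mul_of_commute fun i j => commute_of_disjoint hAB (hS i) (hT j)] at h
  have hA := wordEval_mem_of_forall_mem hS w
  have hB := wordEval_mem_of_forall_mem hT w
  have hS1 : wordEval S w = 1 := by
    ext t
    by_cases ht : t ∈ A
    · rw [eq_inv_of_mul_eq_one_left h]
      exact inv_mem hB t (Set.disjoint_left.1 hAB ht)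
    · exact hA t ht
  rw [hS1, one_mul] at h
  exact ⟨hS1, h⟩

theorem wordEval_conj {G : Type} [Group G] (z : G) (S : Fin k → G) (w : List (Fin k × Bool)) :
    wordEval (fun i => z * S i * z⁻¹) w = z * wordEval S w * z⁻¹ :=
  (map_wordEval (MulAut.conj z).toMonoidHom S w).symm

theorem exists_wordEval_ne_one {w : List (Fin k × Bool)} (hw : FreeGroup.mk w ≠ 1) :
    ∃ (S : Fin k → ℝ ≃o ℝ) (D : ℕ), (∀ i, S i ∈ F) ∧ (∀ i, S i ∈ supportedIn (Set.Ioo (0 : ℝ) D)) ∧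
      wordEval S w ≠ 1 := by
  obtain ⟨x, v, hv⟩ : ∃ x v, (FreeGroup.mk w).toWord = x :: v :=
    List.exists_cons_of_ne_nil fun h => hw (FreeGroup.toWord_eq_nil_iff.1 h)
  have hred : FreeGroup.IsReduced (x :: v) := hv ▸ FreeGroup.isReduced_toWord
  obtain ⟨L, hL, hact⟩ := exists_runs x v hred
  obtain ⟨S, hSF, hS, -, hf⟩ := exists_follows L x 0 hL
  refine ⟨S, 4 * L.length + 8, hSF, fun i => ?_, fun h => ?_⟩
  · simpa using hS i
  · have h1 := hact S 0 hf 1 (by norm_num)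
    rw [← hv, wordEval_eq_lift, FreeGroup.mk_toWord, ← wordEval_eq_lift, h] at h1
    norm_num at h1

/-- The tuples for the individual words are translated side by side and multiplied; by
`wordEval_eq_one_of_mul` a relation of the product is a relation of every factor. -/
theorem exists_forall_wordEval_ne_one (W : Finset (List (Fin k × Bool)))
    (hW : ∀ w ∈ W, FreeGroup.mk w ≠ 1) :
    ∃ (S : Fin k → ℝ ≃o ℝ) (D : ℕ), (∀ i, S i ∈ F) ∧ (∀ i, S i ∈ supportedIn (Set.Ioo (0 : ℝ) D)) ∧
      ∀ w ∈ W, wordEval S w ≠ 1 := by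
  classical
  induction W using Finset.induction_on with
  | empty => exact ⟨fun _ => 1, 0, fun _ => one_mem _, fun _ => one_mem _, by simp⟩
  | insert w W _ ih =>
    obtain ⟨S, D, hSF, hS, hSW⟩ := ih fun v hv => hW v (Finset.mem_insert_of_mem hv)
    obtain ⟨T, E, hTF, hT, hTw⟩ := exists_wordEval_ne_one (hW w (Finset.mem_insert_self _ _))
    have hT' : ∀ i, f₁ ^ (D : ℤ) * T i * (f₁ ^ (D : ℤ))⁻¹ ∈
        supportedIn (Set.Ioo (D : ℝ) (D + E : ℕ)) := fun i =>
      conj_mem_supportedIn (hT i) fun t ht => by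
        rw [f₁_zpow_apply]
        push_cast
        exact ⟨by linarith [ht.1], by linarith [ht.2]⟩
    have hdisj : Disjoint (Set.Ioo (0 : ℝ) D) (Set.Ioo (D : ℝ) (D + E : ℕ)) :=
      Set.disjoint_left.2 fun t ht ht' => by linarith [ht.2, ht'.1]
    have h1 : ∀ i, T i ∈ F → f₁ ^ (D : ℤ) * T i * (f₁ ^ (D : ℤ))⁻¹ ∈ F := fun i hi =>
      mul_mem (mul_mem (zpow_mem f₁_mem _) hi) (inv_mem (zpow_mem f₁_mem _))
    refine ⟨fun i => S i * (f₁ ^ (D : ℤ) * T i * (f₁ ^ (D : ℤ))⁻¹), D + E,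
      fun i => mul_mem (hSF i) (h1 i (hTF i)), fun i => mul_mem ?_ ?_, fun v hv h => ?_⟩
    · exact supportedIn_mono (Set.Ioo_subset_Ioo_right (by simp)) (hS i)
    · exact supportedIn_mono (Set.Ioo_subset_Ioo_left (by simp)) (hT' i)
    · obtain ⟨h2, h3⟩ := wordEval_eq_one_of_mul hdisj hS hT' h
      rcases Finset.mem_insert.1 hv with rfl | hv
      · rw [wordEval_conj, conj_eq_one_iff] at h3
        exact hTw h3
      · exact hSW v hv h2

theorem leftGen_one_pow_apply (n : ℕ) : (leftGen 1 ^ n) (-n) = 0 := by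
  induction n with
  | zero => simp
  | succ n ih =>
    have : (0 : ℝ) ≤ n := n.cast_nonneg
    rw [pow_succ, RelIso.mul_apply, leftGen_apply, if_pos (by push_cast; linarith)]
    push_cast
    rw [neg_add, neg_add_cancel_right]
    exact ih

theorem exists_conj_mem_F₂ (D : ℕ) : ∃ z ∈ F, ∀ x ∈ F,
    x ∈ supportedIn (Set.Ioo (-1 : ℝ) (D + 2)) → z * x * z⁻¹ ∈ F₂ := by
  -- The translation takes `[-1, D + 2]` to `[-(D + 2), 1]`; then `leftGen 1` fixes `1` and brings
  -- the left end to `0` in `D + 2` unit steps.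
  set z : ℝ ≃o ℝ := leftGen 1 ^ (D + 2) * f₁ ^ (-(D + 1 : ℤ)) with hz
  have hzF : z ∈ F := mul_mem (pow_mem (leftGen_mem 1) _) (zpow_mem f₁_mem _)
  have h0 : z (-1) = 0 := by
    have := leftGen_one_pow_apply (D + 2)
    rw [hz, RelIso.mul_apply, f₁_zpow_apply, ← this]
    congr 1
    push_cast; ring
  have h1 : z (D + 2) = 1 := by
    have hfix : ∀ n : ℕ, (leftGen 1 ^ n) 1 = 1 := fun n => by
      induction n with
      | zero => simp
      | succ n ih =>
        have := leftGen_apply_self 1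
        push_cast at this
        rw [pow_succ, RelIso.mul_apply, this, ih]
    rw [hz, RelIso.mul_apply, f₁_zpow_apply]
    have : (D : ℝ) + 2 + ((-(D + 1 : ℤ) : ℤ) : ℝ) = 1 := by push_cast; ring
    rw [this, hfix]
  refine ⟨z, hzF, fun x hx hx' => ⟨mul_mem (mul_mem hzF hx) (inv_mem hzF),
    conj_mem_supportedIn hx' fun t ht => ⟨?_, ?_⟩⟩⟩
  · rw [← h0]; exact z.monotone ht.1.le
  · rw [← h1]; exact z.monotone ht.2.le

theorem exists_ballIso (n : ℕ) : ∃ a b : F₂, a ∈ commutator F₂ ∧ b ∈ commutator F₂ ∧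
    BallIso ![a, b] (FreeGroup.of : Fin 2 → FreeGroup (Fin 2)) n := by
  classical
  obtain ⟨S, D, hSF, hS, hSw⟩ := exists_forall_wordEval_ne_one
    ((List.finite_length_le (Fin 2 × Bool) (2 * n + 1)).toFinset.filter
      fun w => FreeGroup.mk w ≠ 1) (fun w hw => (Finset.mem_filter.1 hw).2)
  -- Since `σ` pushes `(0, D)` off itself, the commutator of `S i` with `σ` is `S i` times an
  -- element supported on `[D, ∞)`. Passing to commutators therefore creates no new relations.
  set σ : ℝ ≃o ℝ := bump (-1) (D + 2) ^ D
  have hσF : σ ∈ F := pow_mem (bump_mem _ _) _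
  have hσ : σ ∈ supportedIn (Set.Ioo (-1 : ℝ) (D + 2)) := by
    have := bump_mem_supportedIn (j := -1) (i := D + 2) (by omega)
    push_cast at this
    exact pow_mem this _
  have hσ0 : σ 0 = D := by
    have := bump_pow_apply (j := -1) (i := D + 2) (t := 0) (by norm_num) D
      (by push_cast; linarith)
    rwa [zero_add] at this
  obtain ⟨z, hz, hzx⟩ := exists_conj_mem_F₂ D
  have hS' : ∀ i, S i ∈ supportedIn (Set.Ioo (-1 : ℝ) (D + 2)) := fun i =>
    supportedIn_mono (Set.Ioo_subset_Ioo (by norm_num) (by linarith)) (hS i)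
  let A : Fin 2 → F₂ := fun i =>
    ⁅(⟨_, hzx _ (hSF i) (hS' i)⟩ : F₂), (⟨_, hzx _ hσF hσ⟩ : F₂)⁆
  have hA : ∀ i, A i ∈ commutator F₂ := fun i =>
    Subgroup.commutator_mem_commutator (Subgroup.mem_top _) (Subgroup.mem_top _)
  have hAcoe : ∀ i, (A i : ℝ ≃o ℝ) = z * (S i * (σ * (S i)⁻¹ * σ⁻¹)) * z⁻¹ := fun i => by
    change z * S i * z⁻¹ * (z * σ * z⁻¹) * (z * S i * z⁻¹)⁻¹ * (z * σ * z⁻¹)⁻¹ = _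
    group
  have hvec : ![A 0, A 1] = A := by
    ext i; fin_cases i <;> rfl
  refine ⟨A 0, A 1, hA 0, hA 1, ballIso_of_mk_eq_one fun w hw hw1 => ?_⟩
  by_contra hne
  refine hSw w (by simpa [hne] using hw) ?_
  rw [hvec] at hw1
  have h1 := map_wordEval F₂.subtype A w
  rw [hw1, map_one] at h1
  simp only [Subgroup.subtype_apply, hAcoe] at h1
  rw [wordEval_conj, eq_comm, conj_eq_one_iff] at h1
  refine (wordEval_eq_one_of_mul (B := Set.Ici (D : ℝ)) ?_ hS (fun i => ?_) h1).1
  · exact Set.disjoint_left.2 fun t ht ht' => absurd ht.2 (not_lt.2 ht')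
  · refine conj_mem_supportedIn (inv_mem (hS i)) fun t ht => ?_
    rw [Set.mem_Ici, ← hσ0]
    exact σ.monotone ht.1.le

end Thompson

/-! ### Convergence -/

theorem MarkedGroupSpace.tendsto_mk_of_ballIso {k : ℕ} {G H : Type} [Group G] [Group H]
    {S : ℕ → Fin k → G} {T : Fin k → H} (hS : ∀ n, IsMarking (S n)) (hT : IsMarking T)
    (h : ∀ n, BallIso (S n) T n) :
    Tendsto (fun n => MarkedGroupSpace.mk (S n) (hS n)) atTop (𝓝 (MarkedGroupSpace.mk T hT)) := by
  rw [tendsto_iff_dist_tendsto_zero]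
  refine squeeze_zero (fun _ => dist_nonneg) (fun n => ?_)
    (Real.tendsto_exp_neg_atTop_nhds_zero.comp tendsto_natCast_atTop_atTop)
  exact MarkedGroup.distance_le (A := ⟨G, S n, hS n⟩) (B := ⟨H, T, hT⟩) (h n)

namespace Thompson

theorem isMarking_of_coe_eq {m : ℤ} (hm : 3 ≤ m) {n : ℕ} {a b : F₂} (ha : a ∈ commutator F₂)
    (hb : b ∈ commutator F₂) {g h : F} (hg : (g : ℝ ≃o ℝ) = f₁ * spread m (m + n) a)
    (hh : (h : ℝ ≃o ℝ) = f₂ * spread m (m + n) b) : IsMarking ![g, h] := by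
  constructor
  · have hne : g ≠ h := by
      intro e
      have h1 : (g : ℝ ≃o ℝ) ((-1 : ℤ) : ℝ) = (h : ℝ ≃o ℝ) ((-1 : ℤ) : ℝ) := by rw [e]
      rw [hg, hh, RelIso.mul_apply, RelIso.mul_apply, spread_apply_intCast, spread_apply_intCast,
        f₁_apply, f₂_apply] at h1
      norm_num at h1
    intro i j hij
    fin_cases i <;> fin_cases j <;> first | rfl | exact (hne hij).elim | exact (hne hij.symm).elim
  · rw [eq_top_iff]
    have hmem : ∀ i, ((![g, h] i : F) : ℝ ≃o ℝ) ∈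
        (Subgroup.closure (Set.range ![g, h])).map F.subtype := fun i =>
      ⟨_, Subgroup.subset_closure ⟨i, rfl⟩, rfl⟩
    have hle := F_le_of_mem hm ha hb (hg ▸ hmem 0) (hh ▸ hmem 1)
    intro x _
    obtain ⟨y, hy, hyx⟩ := hle x.2
    rwa [← Subtype.ext hyx]

end Thompson

theorem mainTheorem2 :
    (∃ a b : ℕ → Thompson.F₂, Thompson.LooksFree a b) ∧
    ∃ m₀ : ℤ, ∀ m : ℤ, m₀ ≤ m → ∀ a b : ℕ → Thompson.F₂, Thompson.LooksFree a b →
      ∃ g h : ℕ → Thompson.F,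
        (∀ n : ℕ, (g n : ℝ ≃o ℝ) =
          Thompson.f₁ * Thompson.spread m (m + 2 * (n : ℤ) + 1) (a n)) ∧
        (∀ n : ℕ, (h n : ℝ ≃o ℝ) =
          Thompson.f₂ * Thompson.spread m (m + 2 * (n : ℤ) + 1) (b n)) ∧
        (∀ n : ℕ, BallIso ![g n, h n] (FreeGroup.of : Fin 2 → FreeGroup (Fin 2)) n) ∧
        ∃ hS : ∀ n : ℕ, IsMarking ![g n, h n],
          Tendsto (fun n : ℕ => MarkedGroupSpace.mk ![g n, h n] (hS n)) atTop
            (𝓝 (MarkedGroupSpace.mk FreeGroup.of (isMarking_freeGroup_of 2))) := by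
  constructor
  · choose a b ha hb hab using Thompson.exists_ballIso
    exact ⟨a, b, fun n => ⟨ha n, hb n, hab n⟩⟩
  -- Generation forces the bound `3`; absence of short relations needs only `1 ≤ m`, where `f₂` is
  -- already the unit translation.
  · refine ⟨3, fun m hm a b hab => ?_⟩
    have hlen : ∀ n : ℕ, m + 2 * (n : ℤ) + 1 = m + ((2 * n + 1 : ℕ) : ℤ) := fun n => by
      push_cast; ring
    have hF : ∀ (n : ℕ) (c : Thompson.F₂),
        Thompson.spread m (m + 2 * (n : ℤ) + 1) c ∈ Thompson.F := fun n c => by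
      rw [hlen]; exact Thompson.spread_mem_F _ _ _
    let g : ℕ → Thompson.F := fun n => ⟨_, mul_mem Thompson.f₁_mem (hF n (a n))⟩
    let h : ℕ → Thompson.F := fun n => ⟨_, mul_mem Thompson.f₂_mem (hF n (b n))⟩
    have hball : ∀ n : ℕ, BallIso ![g n, h n] (FreeGroup.of : Fin 2 → FreeGroup (Fin 2)) n := by
      refine fun n => ballIso_of_mk_eq_one fun w hw hw1 => ?_
      refine Thompson.mk_eq_one_of_wordEval_spread (by omega : 1 ≤ m) (hab n).2.2 hw ?_
      have h1 := map_wordEval Thompson.F.subtype ![g n, h n] w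
      rw [hw1, map_one] at h1
      rw [h1]
      congr 1
      ext i
      fin_cases i <;> rfl
    have hS : ∀ n : ℕ, IsMarking ![g n, h n] := fun n =>
      Thompson.isMarking_of_coe_eq hm (hab n).1 (hab n).2.1 (n := 2 * n + 1)
        (by rw [← hlen]) (by rw [← hlen])
    exact ⟨g, h, fun _ => rfl, fun _ => rfl, hball, hS,
      MarkedGroupSpace.tendsto_mk_of_ballIso hS _ hball⟩
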